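/- **Theorem 1 (Achievability).** Let $0<\varepsilon<1$, and let $m=m(n)$ be a sequence of positive integers (for large $n$) with $n=o(m)$ and $m=o(n^2)$ as $n\to\infty$. For each $n$ let $Z_1,\dots,Z_n$ be i.i.d. with values in $[m]=\{1,\dots,m\}$. Under the null hypothesis their p.m.f. is the uniform one, $p_j=1/m$; under the alternative it is some $q\in\mathcal Q_n$, the set of all p.m.f.s $q$ on $[m]$ with $\sup_{B\subseteq[m]}|q(B)-p(B)|\ge\varepsilon$. For a sequence of tests $\phi=(\phi_n)$, $\phi_n:[m]^n\to\{0,1\}$, put $P_F(\phi_n)=\mathsf P_p\{\phi_n(Z_1^n)=1\}$, $P_M(\phi_n)=\sup_{q\in\mathcal Q_n}\mathsf P_q\{\phi_n(Z_1^n)=0\}$, and define the generalized error exponents $$J_F(\phi)=-\limsup_{n\to\infty}\frac{m}{n^2}\log P_F(\phi_n),\qquad J_M(\phi)=-\limsup_{n\to\infty}\frac{m}{n^2}\log P_M(\phi_n)$$ (with $\log 0=-\infty$). Let $S_n^*$ be minus the number of symbols of $[m]$ that occur exactly once in $Z_1,\dots,Z_n$. The coincidence-based test with thresholds $\tau_n\in\mathbb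 R$ is $\phi^*_n=\mathbb I\{S_n^*\ge \mathsf E_p[S_n^*]+\tau_n\}$. Let $\underline\kappa(\varepsilon)=1+4\varepsilon^2$ if $\varepsilon<1/2$ and $\underline\kappa(\varepsilon)=1+\varepsilon/(1-\varepsilon)$ if $\varepsilon\ge 1/2$. Then, for every $\tau\in[0,\underline\kappa(\varepsilon)-1]$ and every sequence of thresholds with $\lim_{n\to\infty} m\tau_n/n^2=\tau$, $$J_F(\phi^*)=J_F^*(\tau):=\sup_{\theta\ge0}\Bigl\{\theta\tau-\tfrac12\bigl(e^{2\theta}-(1+2\theta)\bigr)\Bigr\},$$ $$J_M(\phi^*)=J_M^*(\tau):=\sup_{\theta\ge0}\Bigl\{\theta\bigl(\underline\kappa(\varepsilon)-1-\tau\bigr)-\tfrac12\bigl(e^{-2\theta}-(1-2\theta)\bigr)\underline\kappa(\varepsilon)\Bigr\}.$$ -/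

import Mathlib

open Filter Topology Asymptotics
open scoped ENNReal

noncomputable section

namespace SmallSample

/-- The uniform p.m.f. on an alphabet with `m` symbols. -/
def uniformPMF (m : ℕ) : Fin m → ℝ := fun _ => 1 / (m : ℝ)

/-- The total variation distance `sup_B |q(B) - p(B)|` over all subsets `B` of the alphabet. -/
def tvDist {m : ℕ} (q p : Fin m → ℝ) : ℝ :=
  ⨆ B : Finset (Fin m), |∑ j ∈ B, q j - ∑ j ∈ B, p j|

/-- The alternatives: all p.m.f.s on the alphabet at total variation distance at least `ε`
from the uniform one. -/
def alternatives (m : ℕ) (ε : ℝ) : Set (Fin m → ℝ) :=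
  {q | q ∈ stdSimplex ℝ (Fin m) ∧ ε ≤ tvDist q (uniformPMF m)}

open Classical in
/-- The probability of the event `A` when `Z_1, …, Z_n` are i.i.d. with p.m.f. `q`. -/
def iidProb {m n : ℕ} (q : Fin m → ℝ) (A : Set (Fin n → Fin m)) : ℝ :=
  ∑ z : Fin n → Fin m, if z ∈ A then ∏ i, q (z i) else 0

/-- The expectation of `S(Z_1, …, Z_n)` when `Z_1, …, Z_n` are i.i.d. with p.m.f. `q`. -/
def iidExp {m n : ℕ} (q : Fin m → ℝ) (S : (Fin n → Fin m) → ℝ) : ℝ :=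
  ∑ z : Fin n → Fin m, (∏ i, q (z i)) * S z

/-- A test: for each sample size `n`, a decision in `{0, 1}` from `n` observations in an alphabet
with `m n` symbols; `0` accepts the null hypothesis. -/
abbrev Test (m : ℕ → ℕ) : Type := ∀ n : ℕ, (Fin n → Fin (m n)) → Fin 2

/-- Probability of false alarm. -/
def falseAlarm {m n : ℕ} (φ : (Fin n → Fin m) → Fin 2) : ℝ≥0∞ :=
  ENNReal.ofReal (iidProb (uniformPMF m) {z | φ z = 1})

/-- Worst-case probability of missed detection over the alternatives. -/
def missedDetection {m n : ℕ} (ε : ℝ) (φ : (Fin n → Fin m) → Fin 2) : ℝ≥0∞ :=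
  ⨆ q ∈ alternatives m ε, ENNReal.ofReal (iidProb q {z | φ z = 0})

/-- `- limsup_n (1 / r) log (P n)` with `r = n² / m`; here `log 0 = -∞`. -/
def genErrorExponent (m : ℕ → ℕ) (P : ℕ → ℝ≥0∞) : EReal :=
  - limsup (fun n : ℕ => ((1 / ((n : ℝ) ^ 2 / (m n : ℝ)) : ℝ) : EReal) * ENNReal.log (P n)) atTop

/-- Generalized error exponent of false alarm. -/
def exponentF {m : ℕ → ℕ} (φ : Test m) : EReal :=
  genErrorExponent m (fun n => falseAlarm (φ n))

/-- Generalized error exponent of missed detection. -/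
def exponentM {m : ℕ → ℕ} (ε : ℝ) (φ : Test m) : EReal :=
  genErrorExponent m (fun n => missedDetection ε (φ n))

/-- The number of times that the symbol `j` occurs in the sample `z`. -/
def occurrences {m n : ℕ} (z : Fin n → Fin m) (j : Fin m) : ℕ :=
  (Finset.univ.filter (fun i => z i = j)).card

/-- Minus the number of symbols that occur exactly once in the sample. -/
def coincidenceStat {m n : ℕ} (z : Fin n → Fin m) : ℝ :=
  - ∑ j : Fin m, if occurrences z j = 1 then (1 : ℝ) else 0

open Classical in
/-- The coincidence-based test with thresholds `τ n`. -/
def coincidenceTest (m : ℕ → ℕ) (τ : ℕ → ℝ) : Test m := fun n z =>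
  if iidExp (uniformPMF (m n)) (coincidenceStat (m := m n) (n := n)) + τ n ≤ coincidenceStat z
  then 1 else 0

/-- The function `κ̲(ε)`. -/
def kappaLow (ε : ℝ) : ℝ :=
  if ε < 1 / 2 then 1 + 4 * ε ^ 2 else 1 + ε / (1 - ε)

/-- `J_F^*(τ)`. -/
def JFstar (τ : ℝ) : EReal :=
  ⨆ (θ : ℝ) (_ : 0 ≤ θ),
    ((θ * τ - 1 / 2 * (Real.exp (2 * θ) - (1 + 2 * θ)) : ℝ) : EReal)

/-- `J_M^*(τ)`. -/
def JMstar (ε τ : ℝ) : EReal :=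
  ⨆ (θ : ℝ) (_ : 0 ≤ θ),
    ((θ * (kappaLow ε - 1 - τ)
      - 1 / 2 * (Real.exp (-2 * θ) - (1 - 2 * θ)) * kappaLow ε : ℝ) : EReal)

end SmallSample

end

/-!
Write `r = n ^ 2 / m`, and let `T = n + S` be the number of observations that share their symbol
with another observation. The test rejects when `T ≥ t` with `t = n + E_p S + τ_n ∼ (1 + τ) r`
(`tendsto_threshold`). In the regime `n ≪ m ≪ n ^ 2` almost all coincidences are pairs, and if
`m ∑ q_j ^ 2` is close to `κ`, then `T / 2` behaves like a Poisson variable of mean `κ r / 2`; both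
exponents are its Cramér rate function at `(1 + τ) r / 2`, with `κ = 1` for the uniform p.m.f. and
`κ` the smallest possible value, `kappaLow ε`, for the alternatives.

*Lower bounds on the probabilities* (`eventually_exp_le_iidProb`). The event that exactly `k`
symbols occur twice and all others at most once has `T = 2 k`. By the multinomial theorem its
probability is `n! / 2 ^ k` times a sum of products `∏_S q ∏_V q ^ 2` over disjoint `S`, `V` of sizes
`n - 2 k` and `k`. This sum is bounded below through the ratio of consecutive elementary symmetric
polynomials, which is where `∑ q_j ^ 2`, and not just `max q_j`, enters. For missed detection this is
applied to a p.m.f. with two values, at distance at least `ε` from the uniform one and with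
`m ∑ q_j ^ 2 → kappaLow ε` (`exists_extremal_alternatives`).

*Upper bound, false alarm* (`iidProb_uniform_le_exp`). `T` is at most twice the number of
observations that repeat an earlier one, and the `i`-th observation is a repetition with conditional
probability at most `(i - 1) / m`; then use Markov's inequality for the exponential moment.

*Upper bound, missed detection* (`eventually_missedDetection_le`). For `u ≤ 1` the expectation of
`u ^ T` decreases with the sample size, so it can be compared with that of a Poisson number, of mean
`c = (1 - δ) n`, of observations, under which the counts of the symbols are independent. This costs
only a constant factor, which matters because `r` may tend to infinity arbitrarily slowly. Each
symbol then contributes a factor whose logarithm is at most `- K (2 s y - s ^ 2)`, `y = c q_j`, for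
every `s` in a fixed interval `[0, A]` (`exists_exp_add_le_exp`). These tangent lines of `y ^ 2`
are combined into a bound linear in `m q_j` and `|m q_j - 1|` (`exists_tangent_certificate`), whose
sum over `j` is controlled by the total variation distance, uniformly over all alternatives.
-/

namespace SmallSample

/-! ### Samples and their occurrence vectors -/

/-- The contribution to `collisionStat` of a symbol that occurs `k` times. -/
def nonSingle (k : ℕ) : ℕ := if k = 1 then 0 else k

/-- The number of observations that share their symbol with another observation. -/
def collisionStat {m n : ℕ} (z : Fin n → Fin m) : ℕ := ∑ j, nonSingle (occurrences z j)

theorem sum_occurrences {m n : ℕ} (z : Fin n → Fin m) : ∑ j, occurrences z j = n := by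
  have := Finset.card_eq_sum_card_fiberwise (f := z) (s := Finset.univ) (t := Finset.univ)
    (fun _ _ => Finset.mem_univ _)
  simpa [occurrences] using this.symm

theorem coincidenceStat_eq {m n : ℕ} (z : Fin n → Fin m) :
    coincidenceStat z = collisionStat z - n := by
  have h : ∀ k : ℕ, (k : ℝ) = nonSingle k + if k = 1 then (1 : ℝ) else 0 := by
    intro k
    unfold nonSingle
    split_ifs with h <;> simp [h]
  have h2 : (n : ℝ) = ∑ j, (occurrences z j : ℝ) := by
    exact_mod_cast (sum_occurrences z).symm
  rw [h2, Finset.sum_congr rfl fun j _ => h (occurrences z j), Finset.sum_add_distrib]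
  simp [coincidenceStat, collisionStat]

theorem prod_comp_sample {R : Type*} [CommMonoid R] {m n : ℕ} (z : Fin n → Fin m)
    (q : Fin m → R) : ∏ i, q (z i) = ∏ j, q j ^ occurrences z j := by
  rw [← Finset.prod_fiberwise (s := Finset.univ) (g := z)]
  refine Finset.prod_congr rfl fun j _ => ?_
  rw [occurrences, Finset.prod_congr rfl (g := fun _ => q j), Finset.prod_const]
  intro i hi
  rw [(Finset.mem_filter.1 hi).2]

/-- The law of the occurrence vector is multinomial. -/
theorem iidExp_comp_occurrences {m n : ℕ} (q : Fin m → ℝ) (F : (Fin m → ℕ) → ℝ) :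
    iidExp (n := n) q (fun z => F (occurrences z)) =
      ∑ x ∈ Finset.piAntidiag Finset.univ n,
        (Nat.multinomial Finset.univ x : ℝ) * ((∏ j, q j ^ x j) * F x) := by
  -- Apply the linear functional that sends the monomial `X ^ x` to `q ^ x * F x` to the
  -- multinomial expansion of `(X_1 + ⋯ + X_m) ^ n`.
  let L : MvPolynomial (Fin m) ℝ →ₗ[ℝ] ℝ :=
    (MvPolynomial.basisMonomials (Fin m) ℝ).constr ℝ fun s => (∏ j, q j ^ s j) * F s
  have hL : ∀ x : Fin m → ℕ, L (∏ j, MvPolynomial.X j ^ x j) = (∏ j, q j ^ x j) * F x := by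
    intro x
    have h1 : (∏ j, MvPolynomial.X j ^ x j : MvPolynomial (Fin m) ℝ) =
        MvPolynomial.basisMonomials (Fin m) ℝ (Finsupp.equivFunOnFinite.symm x) := by
      rw [MvPolynomial.coe_basisMonomials]
      beta_reduce
      rw [MvPolynomial.monomial_eq, Finsupp.prod_fintype] <;> simp
    rw [h1, Module.Basis.constr_basis]
    simp
  have key : ∑ z : Fin n → Fin m, ∏ i, (MvPolynomial.X (z i) : MvPolynomial (Fin m) ℝ) =
      ∑ x ∈ Finset.piAntidiag Finset.univ n,
        (Nat.multinomial Finset.univ x : MvPolynomial (Fin m) ℝ) *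
          ∏ j, MvPolynomial.X j ^ x j := by
    rw [← Finset.sum_pow_eq_sum_piAntidiag, ← Fintype.piFinset_univ, ← Finset.prod_univ_sum]
    simp
  have := congrArg L key
  rw [map_sum, map_sum] at this
  unfold iidExp
  simp only [prod_comp_sample _ q]
  simp only [prod_comp_sample, hL] at this
  rw [this]
  refine Finset.sum_congr rfl fun x _ => ?_
  rw [← nsmul_eq_mul, map_nsmul, hL, nsmul_eq_mul]

theorem iidProb_le_iidExp {m n : ℕ} {q : Fin m → ℝ} (hq : ∀ j, 0 ≤ q j)
    {A : Set (Fin n → Fin m)} {W : (Fin n → Fin m) → ℝ} (h0 : ∀ z, 0 ≤ W z)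
    (hA : ∀ z ∈ A, 1 ≤ W z) : iidProb q A ≤ iidExp q W := by
  unfold iidProb iidExp
  refine Finset.sum_le_sum fun z _ => ?_
  have hp : 0 ≤ ∏ i, q (z i) := Finset.prod_nonneg fun i _ => hq _
  split_ifs with h
  · exact le_mul_of_one_le_right hp (hA z h)
  · exact mul_nonneg hp (h0 z)

theorem iidExp_le_iidProb {m n : ℕ} {q : Fin m → ℝ} (hq : ∀ j, 0 ≤ q j)
    {A : Set (Fin n → Fin m)} {W : (Fin n → Fin m) → ℝ} (h1 : ∀ z, W z ≤ 1)
    (hA : ∀ z, z ∉ A → W z ≤ 0) : iidExp q W ≤ iidProb q A := by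
  unfold iidProb iidExp
  refine Finset.sum_le_sum fun z _ => ?_
  have hp : 0 ≤ ∏ i, q (z i) := Finset.prod_nonneg fun i _ => hq _
  split_ifs with h
  · exact mul_le_of_le_one_right hp (h1 z)
  · exact mul_nonpos_of_nonneg_of_nonpos hp (hA z h)

theorem iidExp_mono {m n : ℕ} {q : Fin m → ℝ} (hq : ∀ j, 0 ≤ q j)
    {W V : (Fin n → Fin m) → ℝ} (h : ∀ z, W z ≤ V z) : iidExp q W ≤ iidExp q V :=
  Finset.sum_le_sum fun z _ =>
    mul_le_mul_of_nonneg_left (h z) (Finset.prod_nonneg fun _ _ => hq _)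

/-- Conditioning on all observations but the first. -/
theorem iidExp_succ {m n : ℕ} (q : Fin m → ℝ) (W : (Fin (n + 1) → Fin m) → ℝ) :
    iidExp q W = iidExp (n := n) q (fun z => ∑ j, q j * W (Fin.cons j z)) := by
  unfold iidExp
  rw [← (Fin.consEquiv fun _ : Fin (n + 1) => Fin m).sum_comp, Fintype.sum_prod_type,
    Finset.sum_comm]
  refine Finset.sum_congr rfl fun z _ => ?_
  rw [Finset.mul_sum]
  refine Finset.sum_congr rfl fun j _ => ?_
  simp only [Fin.consEquiv, Equiv.coe_fn_mk, Fin.prod_univ_succ, Fin.cons_zero, Fin.cons_succ]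
  ring

theorem occurrences_cons {m n : ℕ} (a : Fin m) (z : Fin n → Fin m) (j : Fin m) :
    occurrences (Fin.cons a z : Fin (n + 1) → Fin m) j =
      occurrences z j + if a = j then 1 else 0 := by
  unfold occurrences
  rw [Finset.card_filter, Finset.card_filter, Fin.sum_univ_succ]
  simp [add_comm]

/-! ### Lower bounds for elementary symmetric polynomials -/

/-- Removing an element from a set of size `l + 1` is the same as choosing a set of size `l` and an
element outside it. -/
theorem sum_powersetCard_succ {α : Type*} [DecidableEq α] (U : Finset α) (l : ℕ)
    (g : α → Finset α → ℝ) :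
    ∑ S ∈ U.powersetCard (l + 1), ∑ s ∈ S, g s (S.erase s) =
      ∑ T ∈ U.powersetCard l, ∑ s ∈ U \ T, g s T := by
  rw [Finset.sum_sigma', Finset.sum_sigma']
  refine Finset.sum_bij' (fun p _ => ⟨p.1.erase p.2, p.2⟩) (fun p _ => ⟨insert p.2 p.1, p.2⟩)
    ?_ ?_ ?_ ?_ ?_
  · rintro ⟨S, s⟩ h
    simp only [Finset.mem_sigma, Finset.mem_powersetCard, Finset.mem_sdiff] at h ⊢
    refine ⟨⟨(Finset.erase_subset _ _).trans h.1.1, ?_⟩, h.1.1 h.2, Finset.notMem_erase _ _⟩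
    rw [Finset.card_erase_of_mem h.2, h.1.2, Nat.add_sub_cancel]
  · rintro ⟨S, s⟩ h
    simp only [Finset.mem_sigma, Finset.mem_powersetCard, Finset.mem_sdiff] at h ⊢
    refine ⟨⟨Finset.insert_subset h.2.1 h.1.1, ?_⟩, Finset.mem_insert_self _ _⟩
    rw [Finset.card_insert_of_notMem h.2.2, h.1.2]
  · rintro ⟨S, s⟩ h
    simp only [Finset.mem_sigma] at h
    simp [Finset.insert_erase h.2]
  · rintro ⟨S, s⟩ h
    simp only [Finset.mem_sigma, Finset.mem_sdiff] at h
    simp [Finset.erase_insert h.2.2]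
  · rintro ⟨S, s⟩ _
    rfl

/-- The elementary symmetric polynomial of degree `l` in the values of `a` on `U`. -/
def elemSymm {α : Type*} (a : α → ℝ) (U : Finset α) (l : ℕ) : ℝ :=
  ∑ S ∈ U.powersetCard l, ∏ s ∈ S, a s

theorem elemSymm_nonneg {α : Type*} {a : α → ℝ} (ha : ∀ j, 0 ≤ a j) (U : Finset α) (l : ℕ) :
    0 ≤ elemSymm a U l :=
  Finset.sum_nonneg fun _ _ => Finset.prod_nonneg fun _ _ => ha _

theorem elemSymm_zero {α : Type*} (a : α → ℝ) (U : Finset α) : elemSymm a U 0 = 1 := by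
  simp [elemSymm]

theorem succ_mul_elemSymm_succ {α : Type*} [DecidableEq α] (a : α → ℝ) (U : Finset α) (l : ℕ) :
    (l + 1) * elemSymm a U (l + 1) =
      ∑ T ∈ U.powersetCard l, (∏ t ∈ T, a t) * ∑ s ∈ U \ T, a s := by
  have h := sum_powersetCard_succ U l fun s T => (∏ t ∈ T, a t) * a s
  simp only [← Finset.mul_sum] at h
  rw [← h, elemSymm, Finset.mul_sum]
  refine Finset.sum_congr rfl fun S hS => ?_
  rw [Finset.sum_congr rfl fun s hs => Finset.prod_erase_mul S a hs, Finset.sum_const,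
    (Finset.mem_powersetCard.1 hS).2, nsmul_eq_mul]
  push_cast
  ring

theorem pow_div_factorial_le_elemSymm {α : Type*} [DecidableEq α] {a : α → ℝ} (ha : ∀ j, 0 ≤ a j)
    {b t : ℝ} (hb : ∀ j, a j ≤ b) (ht : 0 ≤ t) (U : Finset α) (k : ℕ)
    (hs : t + k * b ≤ ∑ s ∈ U, a s) (hb0 : 0 ≤ b) :
    t ^ k / k.factorial ≤ elemSymm a U k := by
  suffices ∀ i ≤ k, t ^ i / i.factorial ≤ elemSymm a U i from this k le_rfl
  intro i
  induction i with
  | zero => intro _; simp [elemSymm_zero]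
  | succ i ih =>
    intro hi
    have h1 := ih (by omega)
    have h2 : elemSymm a U i * t ≤ (i + 1) * elemSymm a U (i + 1) := by
      rw [succ_mul_elemSymm_succ, elemSymm, Finset.sum_mul]
      refine Finset.sum_le_sum fun T hT => ?_
      refine mul_le_mul_of_nonneg_left ?_ (Finset.prod_nonneg fun _ _ => ha _)
      obtain ⟨hTU, hTc⟩ := Finset.mem_powersetCard.1 hT
      have h3 := Finset.sum_sdiff (f := a) hTU
      have h4 : ∑ s ∈ T, a s ≤ i * b := by
        have := Finset.sum_le_card_nsmul T a b fun s _ => hb s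
        rwa [hTc, nsmul_eq_mul] at this
      have h5 : (i : ℝ) * b ≤ k * b :=
        mul_le_mul_of_nonneg_right (by exact_mod_cast (by omega : i ≤ k)) hb0
      linarith
    have h3 : (0 : ℝ) < i + 1 := by positivity
    have h4 := mul_le_mul_of_nonneg_right h1 ht
    rw [Nat.factorial_succ, pow_succ, div_le_iff₀ (by positivity)]
    have h5 : (0 : ℝ) < i.factorial := by positivity
    rw [div_mul_eq_mul_div, div_le_iff₀ h5] at h4
    push_cast
    nlinarith [mul_le_mul_of_nonneg_right h2 h5.le]

/-- The right side is `elemSymm q univ (l + 1)` minus the weight of the choices whose next symbol `s` is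
already present; dropping the condition that the other `l` symbols differ from `s` gives the bound. -/
theorem elemSymm_succ_ge {m : ℕ} {q : Fin m → ℝ} (hq : q ∈ stdSimplex ℝ (Fin m)) (l : ℕ) :
    elemSymm q Finset.univ (l + 1) - (∑ j, q j ^ 2) * elemSymm q Finset.univ l ≤
      (l + 2) * elemSymm q Finset.univ (l + 2) := by
  have h0 := succ_mul_elemSymm_succ q Finset.univ (l + 1)
  have h1 : ∀ T : Finset (Fin m), ∑ s ∈ Finset.univ \ T, q s = 1 - ∑ s ∈ T, q s := by
    intro T
    have := Finset.sum_sdiff (f := q) (Finset.subset_univ T)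
    rw [hq.2] at this
    linarith
  simp only [h1, mul_sub, mul_one, Finset.sum_sub_distrib] at h0
  have h2 : ∑ T ∈ Finset.univ.powersetCard (l + 1), (∏ t ∈ T, q t) * ∑ s ∈ T, q s ≤
      (∑ j, q j ^ 2) * elemSymm q Finset.univ l := by
    have h3 := sum_powersetCard_succ (Finset.univ : Finset (Fin m)) l
      fun s T => (∏ t ∈ T, q t) * q s ^ 2
    calc _ = ∑ S ∈ Finset.univ.powersetCard (l + 1), ∑ s ∈ S,
          (∏ t ∈ S.erase s, q t) * q s ^ 2 := by
          refine Finset.sum_congr rfl fun S _ => ?_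
          rw [Finset.mul_sum]
          refine Finset.sum_congr rfl fun s hs => ?_
          rw [← Finset.prod_erase_mul S q hs]
          ring
      _ ≤ _ := by
          rw [h3, elemSymm, Finset.mul_sum]
          refine Finset.sum_le_sum fun T _ => ?_
          rw [← Finset.mul_sum, mul_comm]
          refine mul_le_mul_of_nonneg_right ?_ (Finset.prod_nonneg fun _ _ => hq.1 _)
          exact Finset.sum_le_sum_of_subset_of_nonneg (Finset.subset_univ _)
            fun _ _ _ => sq_nonneg _
  have h4 : elemSymm q Finset.univ (l + 1) =
    ∑ S ∈ Finset.univ.powersetCard (l + 1), ∏ s ∈ S, q s := rfl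
  push_cast at h0
  have h5 : ((l : ℝ) + 1 + 1) = l + 2 := by ring
  rw [h5, show l + 1 + 1 = l + 2 from rfl, ← h4] at h0
  linarith

theorem sum_sq_le_of_le {m : ℕ} {q : Fin m → ℝ} (hq : q ∈ stdSimplex ℝ (Fin m)) {b : ℝ}
    (hb : ∀ j, q j ≤ b) : ∑ j, q j ^ 2 ≤ b := by
  calc ∑ j, q j ^ 2 ≤ ∑ j, b * q j := Finset.sum_le_sum fun j _ => by
        rw [sq]; exact mul_le_mul_of_nonneg_right (hb j) (hq.1 j)
    _ = b := by rw [← Finset.mul_sum, hq.2, mul_one]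

theorem elemSymm_mul_le {m : ℕ} {q : Fin m → ℝ} (hq : q ∈ stdSimplex ℝ (Fin m)) {b : ℝ}
    (hb : ∀ j, q j ≤ b) (l : ℕ) :
    elemSymm q Finset.univ l * (1 - l * b) ≤ (l + 1) * elemSymm q Finset.univ (l + 1) := by
  rw [succ_mul_elemSymm_succ, elemSymm, Finset.sum_mul]
  refine Finset.sum_le_sum fun T hT => ?_
  refine mul_le_mul_of_nonneg_left ?_ (Finset.prod_nonneg fun _ _ => hq.1 _)
  have h3 := Finset.sum_sdiff (f := q) (Finset.subset_univ T)
  have h4 : ∑ s ∈ T, q s ≤ l * b := by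
    have := Finset.sum_le_card_nsmul T q b fun s _ => hb s
    rwa [(Finset.mem_powersetCard.1 hT).2, nsmul_eq_mul] at this
  rw [hq.2] at h3
  linarith

theorem exp_neg_div_le_one_sub {x c : ℝ} (hc : x + c ≤ 1) (h0 : 0 ≤ x) (hc0 : 0 < c) :
    Real.exp (-(x / c)) ≤ 1 - x := by
  have h1 : 0 < 1 - x := by linarith
  rw [← Real.log_le_log_iff (Real.exp_pos _) h1, Real.log_exp]
  have h2 := Real.one_sub_inv_le_log_of_pos h1
  have h3 : 1 - (1 - x)⁻¹ = -(x / (1 - x)) := by field_simp; ring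
  have h4 : x / (1 - x) ≤ x / c := by gcongr; linarith
  linarith

/-- The left side has `∑ q_j ^ 2` to first order; the quantity on the right is the probability that `l`
independent observations are distinct. -/
theorem exp_le_factorial_mul_elemSymm {m : ℕ} {q : Fin m → ℝ} (hq : q ∈ stdSimplex ℝ (Fin m))
    {b : ℝ} (hb : ∀ j, q j ≤ b) (hb0 : 0 ≤ b) {N : ℕ} (hN : 2 * (N * b) < 1) (l : ℕ)
    (hl : l ≤ N) :
    Real.exp (-((∑ j, q j ^ 2) * l ^ 2 / (2 * (1 - 2 * (N * b))))) ≤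
      l.factorial * elemSymm q Finset.univ l := by
  set σ := ∑ j, q j ^ 2 with hσ
  have hσb : σ ≤ b := sum_sq_le_of_le hq hb
  have hσ0 : 0 ≤ σ := Finset.sum_nonneg fun _ _ => sq_nonneg _
  have hNb : 0 ≤ N * b := by positivity
  set c := 1 - 2 * (N * b) with hc
  have hc0 : 0 < c := by linarith
  -- The ratio of consecutive terms is at least `1 - l σ / (1 - N b)`.
  have step : ∀ l : ℕ, l ≤ N → elemSymm q Finset.univ l * Real.exp (-(l * σ / c)) ≤
      (l + 1) * elemSymm q Finset.univ (l + 1) := by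
    intro l hl
    rcases l with _ | l
    · have := elemSymm_mul_le hq hb 0
      simpa using this
    · have h1 := elemSymm_succ_ge hq l
      have h2 := elemSymm_mul_le hq hb l
      set e0 := elemSymm q Finset.univ l
      set e1 := elemSymm q Finset.univ (l + 1)
      have he0 : 0 ≤ e0 := elemSymm_nonneg hq.1 _ _
      have he1 : 0 ≤ e1 := elemSymm_nonneg hq.1 _ _
      have hlN : ((l : ℝ) + 1) ≤ N := by exact_mod_cast hl
      have hD : 0 < 1 - N * b := by linarith
      have h3 : e0 * (1 - N * b) ≤ (l + 1) * e1 := by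
        refine le_trans (mul_le_mul_of_nonneg_left ?_ he0) h2
        have : (l : ℝ) * b ≤ N * b := mul_le_mul_of_nonneg_right (by linarith) hb0
        linarith
      have h4 : e0 ≤ (l + 1) * e1 / (1 - N * b) := by rwa [le_div_iff₀ hD]
      have hx : (l + 1) * σ ≤ N * b := mul_le_mul hlN hσb hσ0 (by positivity)
      have h5 : Real.exp (-((l + 1) * σ / c)) ≤ 1 - (l + 1) * σ / (1 - N * b) := by
        have := exp_neg_div_le_one_sub (x := (l + 1) * σ / (1 - N * b)) (c := c / (1 - N * b))
          (by rw [← add_div, div_le_one hD]; linarith) (by positivity) (by positivity)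
        rwa [div_div_div_cancel_right₀ hD.ne'] at this
      have h6 := mul_le_mul_of_nonneg_left h5 he1
      have h7 := mul_le_mul_of_nonneg_left h4 hσ0
      have h8 : e1 * (1 - (l + 1) * σ / (1 - N * b)) = e1 - σ * ((l + 1) * e1 / (1 - N * b)) := by
        ring
      push_cast
      have h9 : ((l : ℝ) + 1 + 1) = l + 2 := by ring
      rw [h9]
      linarith
  induction l with
  | zero => simp [elemSymm_zero]
  | succ l ih =>
    have h1 := ih (by omega)
    have h2 := step l (by omega)
    have h3 : Real.exp (-(σ * ((l + 1 : ℕ) : ℝ) ^ 2 / (2 * c))) ≤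
        Real.exp (-(σ * (l : ℝ) ^ 2 / (2 * c))) * Real.exp (-(l * σ / c)) := by
      rw [← Real.exp_add, Real.exp_le_exp]
      have : -(σ * ((l + 1 : ℕ) : ℝ) ^ 2 / (2 * c)) =
        -(σ * (l : ℝ) ^ 2 / (2 * c)) + -(l * σ / c) - σ / (2 * c) := by
        push_cast; field_simp; ring
      have h4 : 0 ≤ σ / (2 * c) := by positivity
      linarith
    refine h3.trans ((mul_le_mul_of_nonneg_right h1 (Real.exp_pos _).le).trans ?_)
    rw [Nat.factorial_succ, mul_assoc]
    refine (mul_le_mul_of_nonneg_left h2 (Nat.cast_nonneg _)).trans_eq ?_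
    push_cast
    ring

/-! ### Probability of a prescribed number of pairs -/

/-- The vector of occurrences in which the symbols of `S` occur once and those of `V` twice. -/
def singlesAndPairs {m : ℕ} (S V : Finset (Fin m)) (j : Fin m) : ℕ :=
  if j ∈ S then 1 else if j ∈ V then 2 else 0

theorem prod_singlesAndPairs {R : Type*} [CommMonoid R] {m : ℕ} {S V : Finset (Fin m)}
    (h : Disjoint S V) (f : Fin m → ℕ → R) (hf : ∀ j, f j 0 = 1) :
    ∏ j, f j (singlesAndPairs S V j) = (∏ j ∈ S, f j 1) * ∏ j ∈ V, f j 2 := by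
  rw [← Finset.prod_subset (Finset.subset_univ (S ∪ V)), Finset.prod_union h]
  · congr 1
    · exact Finset.prod_congr rfl fun j hj => by simp [singlesAndPairs, hj]
    · exact Finset.prod_congr rfl fun j hj => by
        simp [singlesAndPairs, hj, Finset.disjoint_right.1 h hj]
  · intro j _ hj
    rw [Finset.mem_union, not_or] at hj
    simp [singlesAndPairs, hj, hf]

theorem sum_singlesAndPairs {m : ℕ} {S V : Finset (Fin m)}
    (h : Disjoint S V) (f : ℕ → ℕ) (hf : f 0 = 0) :
    ∑ j, f (singlesAndPairs S V j) = S.card * f 1 + V.card * f 2 := by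
  have := prod_singlesAndPairs (R := Multiplicative ℕ) h (fun _ k => Multiplicative.ofAdd (f k))
    (fun _ => by simp [hf])
  rw [← ofAdd_sum, ← ofAdd_sum, ← ofAdd_sum, ← ofAdd_add, Multiplicative.ofAdd.injective.eq_iff]
    at this
  simpa using this

theorem multinomial_singlesAndPairs {m : ℕ} {S V : Finset (Fin m)} (h : Disjoint S V) :
    (Nat.multinomial Finset.univ (singlesAndPairs S V) : ℝ) =
      (S.card + 2 * V.card).factorial / 2 ^ V.card := by
  have h1 := Nat.multinomial_spec Finset.univ (singlesAndPairs S V)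
  rw [prod_singlesAndPairs h (fun _ k => k.factorial) (fun _ => rfl),
    sum_singlesAndPairs h (fun k => k) rfl] at h1
  simp only [Nat.factorial, Finset.prod_const] at h1
  rw [eq_div_iff (by positivity)]
  rw [mul_comm V.card 2] at h1
  have h2 : 2 ^ V.card * Nat.multinomial Finset.univ (singlesAndPairs S V) =
      (S.card + 2 * V.card).factorial := by simpa using h1
  rw [← h2]
  push_cast
  ring

theorem sum_elemSymm_le_iidProb {m n l k : ℕ} {q : Fin m → ℝ} (hq : ∀ j, 0 ≤ q j)
    (hn : n = l + 2 * k) :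
    (n.factorial : ℝ) / 2 ^ k * ∑ S ∈ Finset.univ.powersetCard l,
        (∏ s ∈ S, q s) * elemSymm (fun j => q j ^ 2) (Finset.univ \ S) k ≤
      iidProb q {z : Fin n → Fin m | collisionStat z = 2 * k} := by
  refine le_trans ?_ (iidExp_le_iidProb (n := n) hq
    (W := fun z => (fun x : Fin m → ℕ => if ∑ j, nonSingle (x j) = 2 * k then (1 : ℝ) else 0)
      (occurrences z))
    (fun z => by dsimp only; split_ifs <;> norm_num)
    (fun z hz => by
      have : ¬ ∑ j, nonSingle (occurrences z j) = 2 * k := hz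
      simp [this]))
  rw [iidExp_comp_occurrences q
    fun x : Fin m → ℕ => if ∑ j, nonSingle (x j) = 2 * k then (1 : ℝ) else 0]
  set P := (Finset.univ.powersetCard l).sigma
    fun S : Finset (Fin m) => (Finset.univ \ S).powersetCard k with hP
  have hmem : ∀ p ∈ P, p.1.card = l ∧ p.2.card = k ∧ Disjoint p.1 p.2 := by
    rintro ⟨S, V⟩ hp
    rw [hP, Finset.mem_sigma, Finset.mem_powersetCard, Finset.mem_powersetCard] at hp
    exact ⟨hp.1.2, hp.2.2, (Finset.disjoint_of_subset_left hp.2.1 Finset.sdiff_disjoint).symm⟩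
  have hinj : Set.InjOn (fun p : (_ : Finset (Fin m)) × Finset (Fin m) =>
      singlesAndPairs p.1 p.2) P := by
    rintro ⟨S, V⟩ hp ⟨S', V'⟩ hp' h
    have h1 := (hmem _ hp).2.2
    have h2 := (hmem _ hp').2.2
    have hS : S = S' := by
      ext j
      have := congrFun h j
      simp only [singlesAndPairs] at this
      split_ifs at this <;> simp_all
    have hV : V = V' := by
      ext j
      have := congrFun h j
      have h3 : j ∈ S → j ∉ V := fun h => Finset.disjoint_left.1 h1 h
      have h4 : j ∈ S' → j ∉ V' := fun h => Finset.disjoint_left.1 h2 h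
      simp only [singlesAndPairs] at this h3 h4
      split_ifs at this <;> simp_all
    subst hS hV
    rfl
  refine le_trans (le_of_eq ?_) (Finset.sum_le_sum_of_subset_of_nonneg
    (s := P.image fun p => singlesAndPairs p.1 p.2) ?_ ?_)
  · rw [Finset.sum_image hinj, hP, Finset.sum_sigma, Finset.mul_sum]
    refine Finset.sum_congr rfl fun S hS => ?_
    rw [elemSymm, Finset.mul_sum, Finset.mul_sum]
    refine Finset.sum_congr rfl fun V hV => ?_
    obtain ⟨h1, h2, h3⟩ := hmem ⟨S, V⟩ (Finset.mem_sigma.2 ⟨hS, hV⟩)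
    dsimp only at h1 h2 h3 ⊢
    rw [multinomial_singlesAndPairs h3, prod_singlesAndPairs h3 (fun j i => q j ^ i) (by simp),
      sum_singlesAndPairs h3 nonSingle rfl, h1, h2, ← hn]
    simp [nonSingle, mul_comm]
  · intro x hx
    obtain ⟨p, hp, rfl⟩ := Finset.mem_image.1 hx
    obtain ⟨h1, h2, h3⟩ := hmem p hp
    rw [Finset.mem_piAntidiag]
    refine ⟨?_, fun _ _ => Finset.mem_univ _⟩
    have := sum_singlesAndPairs h3 (fun k => k) rfl
    rw [h1, h2] at this
    rw [this, hn]
    ring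
  · intro x _ _
    have : 0 ≤ ∏ j, q j ^ x j := Finset.prod_nonneg fun _ _ => pow_nonneg (hq _) _
    split_ifs
    · positivity
    · simp

theorem le_iidProb_collisionStat_eq {m n l k : ℕ} {q : Fin m → ℝ} (hq : q ∈ stdSimplex ℝ (Fin m))
    {b : ℝ} (hb : ∀ j, q j ≤ b) (hb0 : 0 ≤ b) (hnb : 2 * (n * b) < 1) (hn : n = l + 2 * k)
    (hσ : n * b ^ 2 ≤ ∑ j, q j ^ 2) :
    ((l : ℝ) ^ 2 * (∑ j, q j ^ 2 - n * b ^ 2) / 2) ^ k / k.factorial *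
        Real.exp (-((∑ j, q j ^ 2) * n ^ 2 / (2 * (1 - 2 * (n * b))))) ≤
      iidProb q {z : Fin n → Fin m | collisionStat z = 2 * k} := by
  set σ := ∑ j, q j ^ 2 with hσdef
  have hσ0 : 0 ≤ σ := Finset.sum_nonneg fun _ _ => sq_nonneg _
  set t := σ - n * b ^ 2 with ht
  have ht0 : 0 ≤ t := by linarith
  have hc : 0 < 1 - 2 * (n * b) := by linarith
  refine le_trans ?_ (sum_elemSymm_le_iidProb hq.1 hn)
  have h1 : elemSymm q Finset.univ l * (t ^ k / k.factorial) ≤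
      ∑ S ∈ Finset.univ.powersetCard l,
        (∏ s ∈ S, q s) * elemSymm (fun j => q j ^ 2) (Finset.univ \ S) k := by
    rw [elemSymm, Finset.sum_mul]
    refine Finset.sum_le_sum fun S hS => ?_
    refine mul_le_mul_of_nonneg_left ?_ (Finset.prod_nonneg fun _ _ => hq.1 _)
    have hb2 : ∀ j, q j ^ 2 ≤ b ^ 2 := fun j => pow_le_pow_left₀ (hq.1 j) (hb j) 2
    refine pow_div_factorial_le_elemSymm (fun j => sq_nonneg (q j)) hb2 ht0 _ k ?_ (sq_nonneg b)
    have h3 := Finset.sum_sdiff (f := fun j => q j ^ 2) (Finset.subset_univ S)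
    have h4 : ∑ s ∈ S, q s ^ 2 ≤ l * b ^ 2 := by
      have := Finset.sum_le_card_nsmul S (fun j => q j ^ 2) (b ^ 2) fun s _ => hb2 s
      rwa [(Finset.mem_powersetCard.1 hS).2, nsmul_eq_mul] at this
    have h5 : (n : ℝ) = l + 2 * k := by exact_mod_cast hn
    have h6 : (0 : ℝ) ≤ k * b ^ 2 := by positivity
    rw [ht, h5]
    linarith
  have h2 := exp_le_factorial_mul_elemSymm hq hb hb0 hnb l (by omega)
  have h3 : Real.exp (-(σ * n ^ 2 / (2 * (1 - 2 * (n * b))))) ≤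
      l.factorial * elemSymm q Finset.univ l := by
    refine le_trans (Real.exp_le_exp.2 (neg_le_neg ?_)) h2
    gcongr
    omega
  have h4 : (l.factorial : ℝ) * (l : ℝ) ^ (2 * k) ≤ n.factorial := by
    have := Nat.factorial_mul_pow_le_factorial (m := l) (n := 2 * k)
    have h5 : l.factorial * l ^ (2 * k) ≤ n.factorial := by
      rw [hn]
      exact le_trans (Nat.mul_le_mul_left _ (Nat.pow_le_pow_left (Nat.le_succ l) _)) this
    exact_mod_cast h5
  refine le_trans ?_ (mul_le_mul_of_nonneg_left h1 (by positivity))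
  have he : 0 ≤ elemSymm q Finset.univ l := elemSymm_nonneg hq.1 _ _
  calc _ ≤ ((l : ℝ) ^ 2 * t / 2) ^ k / k.factorial *
        (l.factorial * elemSymm q Finset.univ l) := by gcongr
    _ = (l.factorial * (l : ℝ) ^ (2 * k)) / 2 ^ k *
        (elemSymm q Finset.univ l * (t ^ k / k.factorial)) := by
        rw [div_pow, mul_pow, ← pow_mul]; ring
    _ ≤ _ := by gcongr

/-! ### Moment bounds for the collision statistic -/

theorem uniformPMF_nonneg {m : ℕ} (j : Fin m) : 0 ≤ uniformPMF m j := by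
  unfold uniformPMF; positivity

/-- The number of observations that repeat the symbol of an observation counted before them: a symbol
that occurs `k ≥ 1` times contributes `k - 1` (and `0 - 1 = 0` for an absent symbol). -/
def repeats {m n : ℕ} (z : Fin n → Fin m) : ℕ := ∑ j, (occurrences z j - 1)

theorem collisionStat_le_two_mul_repeats {m n : ℕ} (z : Fin n → Fin m) :
    collisionStat z ≤ 2 * repeats z := by
  unfold collisionStat repeats
  rw [Finset.mul_sum]
  refine Finset.sum_le_sum fun j _ => ?_
  unfold nonSingle
  split_ifs <;> omega

theorem repeats_cons {m n : ℕ} (a : Fin m) (z : Fin n → Fin m) :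
    repeats (Fin.cons a z : Fin (n + 1) → Fin m) =
      repeats z + if 0 < occurrences z a then 1 else 0 := by
  have h : ∀ j, occurrences (Fin.cons a z : Fin (n + 1) → Fin m) j - 1 =
      (occurrences z j - 1) + if a = j then (if 0 < occurrences z a then 1 else 0) else 0 := by
    intro j
    rw [occurrences_cons]
    by_cases hj : a = j
    · subst hj
      simp only [if_true]
      split_ifs <;> omega
    · simp [hj]
  unfold repeats
  rw [Finset.sum_congr rfl fun j _ => h j, Finset.sum_add_distrib]
  simp

theorem iidExp_uniform_pow_repeats_le {m : ℕ} (hm : 0 < m) {v : ℝ} (hv : 1 ≤ v) (n : ℕ) :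
    iidExp (n := n) (uniformPMF m) (fun z => v ^ repeats z) ≤
      Real.exp ((v - 1) * (n ^ 2 / (2 * m))) := by
  have hm' : (0 : ℝ) < m := by exact_mod_cast hm
  induction n with
  | zero => simp [iidExp, repeats, occurrences]
  | succ n ih =>
    have h1 : ∀ z : Fin n → Fin m, ∑ a, uniformPMF m a *
        v ^ repeats (Fin.cons a z : Fin (n + 1) → Fin m) ≤
          v ^ repeats z * (1 + (v - 1) * n / m) := by
      intro z
      have h2 : ∀ a, uniformPMF m a * v ^ repeats (Fin.cons a z : Fin (n + 1) → Fin m) =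
          v ^ repeats z / m * (1 + (v - 1) * if 0 < occurrences z a then 1 else 0) := by
        intro a
        rw [repeats_cons, pow_add, uniformPMF]
        split_ifs <;> ring
      rw [Finset.sum_congr rfl fun a _ => h2 a, ← Finset.mul_sum, Finset.sum_add_distrib,
        ← Finset.mul_sum]
      have h3 : ∑ a, (if 0 < occurrences z a then (1 : ℝ) else 0) ≤ n := by
        have h4 : (n : ℝ) = ∑ j, (occurrences z j : ℝ) := by
          exact_mod_cast (sum_occurrences z).symm
        rw [h4]
        refine Finset.sum_le_sum fun j _ => ?_
        split_ifs with h
        · exact_mod_cast h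
        · positivity
      have hvp : 0 < v ^ repeats z := by positivity
      have h5 : v ^ repeats z * (1 + (v - 1) * n / m) =
          v ^ repeats z / m * (m + (v - 1) * n) := by field_simp
      rw [h5]
      simp only [Finset.sum_const, Finset.card_univ, Fintype.card_fin, nsmul_eq_mul, mul_one]
      have hv0 : 0 ≤ v - 1 := by linarith
      gcongr
    rw [iidExp_succ]
    refine (iidExp_mono uniformPMF_nonneg h1).trans ?_
    have h2 : iidExp (n := n) (uniformPMF m)
        (fun z => v ^ repeats z * (1 + (v - 1) * n / m)) =
        iidExp (n := n) (uniformPMF m) (fun z => v ^ repeats z) * (1 + (v - 1) * n / m) := by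
      unfold iidExp
      rw [Finset.sum_mul]
      exact Finset.sum_congr rfl fun _ _ => by ring
    rw [h2]
    have hv0 : 0 ≤ v - 1 := by linarith
    have h3 : 1 + (v - 1) * n / m ≤ Real.exp ((v - 1) * n / m) := by
      rw [add_comm]; exact Real.add_one_le_exp _
    refine (mul_le_mul ih h3 (by positivity) (Real.exp_pos _).le).trans ?_
    rw [← Real.exp_add, Real.exp_le_exp]
    have h4 : (v - 1) * (((n + 1 : ℕ) : ℝ) ^ 2 / (2 * m)) =
        (v - 1) * (n ^ 2 / (2 * m)) + (v - 1) * n / m + (v - 1) / (2 * m) := by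
      push_cast; field_simp; ring
    have h5 : 0 ≤ (v - 1) / (2 * m) := by positivity
    linarith

theorem iidProb_uniform_le_exp {m n : ℕ} (hm : 0 < m) {θ : ℝ} (hθ : 0 ≤ θ) (t : ℝ) :
    iidProb (uniformPMF m) {z : Fin n → Fin m | t ≤ collisionStat z} ≤
      Real.exp (-(θ * t) + (Real.exp (2 * θ) - 1) * (n ^ 2 / (2 * m))) := by
  have h1 := iidExp_uniform_pow_repeats_le hm (v := Real.exp (2 * θ))
    (Real.one_le_exp (by positivity)) n
  rw [Real.exp_add]
  refine le_trans ?_ (mul_le_mul_of_nonneg_left h1 (Real.exp_pos _).le)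
  have h2 : Real.exp (-(θ * t)) * iidExp (n := n) (uniformPMF m)
      (fun z => Real.exp (2 * θ) ^ repeats z) = iidExp (n := n) (uniformPMF m)
      (fun z => Real.exp (-(θ * t)) * Real.exp (2 * θ) ^ repeats z) := by
    unfold iidExp
    rw [Finset.mul_sum]
    exact Finset.sum_congr rfl fun _ _ => by ring
  rw [h2]
  refine iidProb_le_iidExp uniformPMF_nonneg (fun z => by positivity) fun z hz => ?_
  rw [← Real.exp_nat_mul, ← Real.exp_add]
  refine Real.one_le_exp ?_
  have h3 : (collisionStat z : ℝ) ≤ 2 * repeats z := by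
    exact_mod_cast collisionStat_le_two_mul_repeats z
  have h4 : t ≤ 2 * repeats z := le_trans hz h3
  nlinarith

theorem collisionStat_le_cons {m n : ℕ} (a : Fin m) (z : Fin n → Fin m) :
    collisionStat z ≤ collisionStat (Fin.cons a z : Fin (n + 1) → Fin m) := by
  unfold collisionStat
  refine Finset.sum_le_sum fun j _ => ?_
  rw [occurrences_cons]
  unfold nonSingle
  split_ifs <;> omega

/-- An additional observation never decreases the collision statistic. -/
theorem antitone_iidExp_pow_collisionStat {m : ℕ} {q : Fin m → ℝ}
    (hq : q ∈ stdSimplex ℝ (Fin m)) {u : ℝ} (hu0 : 0 ≤ u) (hu1 : u ≤ 1) :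
    Antitone fun n => iidExp (n := n) q (fun z => u ^ collisionStat z) := by
  refine antitone_nat_of_succ_le fun n => ?_
  rw [iidExp_succ]
  refine iidExp_mono hq.1 fun z => ?_
  calc ∑ a, q a * u ^ collisionStat (Fin.cons a z : Fin (n + 1) → Fin m)
      ≤ ∑ a, q a * u ^ collisionStat z := Finset.sum_le_sum fun a _ =>
        mul_le_mul_of_nonneg_left
          (pow_le_pow_of_le_one hu0 hu1 (collisionStat_le_cons a z)) (hq.1 a)
    _ = u ^ collisionStat z := by rw [← Finset.sum_mul, hq.2, one_mul]

/-- Factorization over the symbols, as for a Poisson number of observations with mean `c`; the common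
factor `exp (-c)` is left out on both sides. -/
theorem pow_div_factorial_mul_iidExp {m : ℕ} (q : Fin m → ℝ) (u c : ℝ) (k : ℕ) :
    c ^ k / k.factorial * iidExp (n := k) q (fun z => u ^ collisionStat z) =
      ∑ x ∈ Finset.piAntidiag Finset.univ k,
        ∏ j, (u ^ nonSingle (x j) * (c * q j) ^ x j / (x j).factorial) := by
  have h := iidExp_comp_occurrences (n := k) q fun x => ∏ j, u ^ nonSingle (x j)
  have h1 : iidExp (n := k) q (fun z => u ^ collisionStat z) =
      iidExp (n := k) q (fun z => ∏ j, u ^ nonSingle (occurrences z j)) := by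
    congr 1
    funext z
    rw [Finset.prod_pow_eq_pow_sum, collisionStat]
  rw [h1, h, Finset.mul_sum]
  refine Finset.sum_congr rfl fun x hx => ?_
  have hs : ∑ j, x j = k := (Finset.mem_piAntidiag.1 hx).1
  have h2 := Nat.multinomial_spec Finset.univ x
  rw [hs] at h2
  have h3 : (∏ j, ((x j).factorial : ℝ)) * Nat.multinomial Finset.univ x = k.factorial := by
    exact_mod_cast h2
  have h4 : (∏ j, ((x j).factorial : ℝ)) ≠ 0 :=
    Finset.prod_ne_zero_iff.2 fun j _ => by positivity
  have h5 : (k.factorial : ℝ) ≠ 0 := by positivity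
  rw [Finset.prod_div_distrib, Finset.prod_mul_distrib]
  simp only [mul_pow]
  rw [Finset.prod_mul_distrib, Finset.prod_pow_eq_pow_sum Finset.univ x c, hs,
    eq_div_iff h4, div_mul_eq_mul_div, div_mul_eq_mul_div, div_eq_iff h5, ← h3]
  ring

theorem sum_pow_div_factorial_mul_iidExp_le {m : ℕ} {q : Fin m → ℝ} (hq : ∀ j, 0 ≤ q j)
    {u c : ℝ} (hu0 : 0 ≤ u) (hu1 : u ≤ 1) (hc : 0 ≤ c) (n : ℕ) :
    ∑ k ∈ Finset.range (n + 1),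
        c ^ k / k.factorial * iidExp (n := k) q (fun z => u ^ collisionStat z) ≤
      ∏ j, (Real.exp (u * (c * q j)) + (1 - u) * (c * q j)) := by
  have hw : ∀ (j : Fin m) (k : ℕ), 0 ≤ u ^ nonSingle k * (c * q j) ^ k / k.factorial := by
    intro j k
    have := hq j
    positivity
  rw [Finset.sum_congr rfl fun k _ => pow_div_factorial_mul_iidExp q u c k,
    ← Finset.sum_biUnion]
  · refine (Finset.sum_le_sum_of_subset_of_nonneg
      (t := Fintype.piFinset fun _ => Finset.range (n + 1)) ?_ ?_).trans ?_
    · intro x hx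
      obtain ⟨k, hk, hxk⟩ := Finset.mem_biUnion.1 hx
      rw [Finset.mem_range] at hk
      rw [Finset.mem_piAntidiag] at hxk
      refine Fintype.mem_piFinset.2 fun j => Finset.mem_range.2 ?_
      have : x j ≤ Finset.univ.sum x :=
        Finset.single_le_sum (fun _ _ => Nat.zero_le _) (Finset.mem_univ j)
      omega
    · exact fun x _ _ => Finset.prod_nonneg fun j _ => hw j _
    · rw [← Finset.prod_univ_sum (fun _ => Finset.range (n + 1))
        fun j k => u ^ nonSingle k * (c * q j) ^ k / k.factorial]
      refine Finset.prod_le_prod (fun j _ => Finset.sum_nonneg fun k _ => hw j k) fun j _ => ?_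
      have hy : 0 ≤ c * q j := mul_nonneg hc (hq j)
      generalize c * q j = y at hy
      calc ∑ k ∈ Finset.range (n + 1), u ^ nonSingle k * y ^ k / k.factorial
          = ∑ k ∈ Finset.range (n + 1),
              ((u * y) ^ k / k.factorial + if k = 1 then (1 - u) * y else 0) := by
            refine Finset.sum_congr rfl fun k _ => ?_
            unfold nonSingle
            split_ifs with h
            · subst h; simp; ring
            · rw [mul_pow]; ring
        _ ≤ _ := by
            rw [Finset.sum_add_distrib]
            refine add_le_add (Real.sum_le_exp_of_nonneg (by positivity) _) ?_
            rw [Finset.sum_ite_eq']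
            have : 0 ≤ (1 - u) * y := mul_nonneg (by linarith) hy
            split_ifs <;> linarith
  · intro k _ k' _ hkk'
    rw [Function.onFun, Finset.disjoint_left]
    intro x hx hx'
    rw [Finset.mem_piAntidiag] at hx hx'
    exact hkk' (hx.1.symm.trans hx'.1)

/-- Chernoff bound for the tail of the exponential series. -/
theorem exp_le_sum_range_add {c s : ℝ} (hc : 0 ≤ c) (hs : 1 ≤ s) (n : ℕ) :
    Real.exp c ≤ ∑ k ∈ Finset.range (n + 1), c ^ k / k.factorial + Real.exp (s * c) / s ^ n := by
  have hexp : ∀ x : ℝ, HasSum (fun k : ℕ => x ^ k / k.factorial) (Real.exp x) := by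
    intro x
    rw [Real.exp_eq_exp_ℝ]
    exact NormedSpace.expSeries_div_hasSum_exp x
  have h2 : HasSum (fun k => if k ∈ Finset.range (n + 1) then c ^ k / (k.factorial : ℝ) else 0)
      (∑ k ∈ Finset.range (n + 1), c ^ k / k.factorial) := by
    have := hasSum_sum_of_ne_finset_zero (L := SummationFilter.unconditional ℕ) (s := Finset.range (n + 1))
      (f := fun k => if k ∈ Finset.range (n + 1) then c ^ k / (k.factorial : ℝ) else 0)
      fun k hk => if_neg hk
    rwa [Finset.sum_congr rfl fun k hk => if_pos hk] at this
  refine hasSum_le (fun k => ?_) (hexp c) (h2.add ((hexp (s * c)).div_const (s ^ n)))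
  have hs0 : 0 < s := by linarith
  have h0 : 0 ≤ c ^ k / (k.factorial : ℝ) := by positivity
  split_ifs with h
  · have : 0 ≤ (s * c) ^ k / k.factorial / s ^ n := by positivity
    linarith
  · rw [zero_add, le_div_iff₀ (by positivity), mul_pow, mul_div_assoc, mul_comm]
    refine mul_le_mul_of_nonneg_right (pow_le_pow_right₀ hs ?_) h0
    rw [Finset.mem_range] at h
    omega

/-- A Poisson variable of mean `(1 - δ) n` is at most `n` with probability at least `1 / 2`,
once `n` is large. -/
theorem eventually_half_exp_le_sum {δ : ℝ} (hδ0 : 0 < δ) (hδ1 : δ < 1) :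
    ∀ᶠ n : ℕ in atTop, Real.exp ((1 - δ) * n) / 2 ≤
      ∑ k ∈ Finset.range (n + 1), ((1 - δ) * n) ^ k / k.factorial := by
  have hpos : 0 < 1 - δ := by linarith
  have hlog : δ + Real.log (1 - δ) < 0 := by
    have := Real.log_lt_sub_one_of_pos hpos (by linarith)
    linarith
  have hlim : Tendsto (fun n : ℕ => Real.exp ((δ + Real.log (1 - δ)) * n)) atTop (𝓝 0) :=
    Real.tendsto_exp_atBot.comp (tendsto_natCast_atTop_atTop.const_mul_atTop_of_neg hlog)
  filter_upwards [hlim.eventually (gt_mem_nhds (by norm_num : (0 : ℝ) < 1 / 2))] with n hn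
  have h := exp_le_sum_range_add (c := (1 - δ) * n) (s := (1 - δ)⁻¹) (by positivity)
    ((one_le_inv₀ hpos).2 (by linarith)) n
  have h1 : Real.exp ((1 - δ)⁻¹ * ((1 - δ) * n)) / (1 - δ)⁻¹ ^ n =
      Real.exp ((1 - δ) * n) * Real.exp ((δ + Real.log (1 - δ)) * n) := by
    rw [inv_mul_cancel_left₀ hpos.ne', inv_pow, div_inv_eq_mul, ← Real.exp_add]
    have : (1 - δ) ^ n = Real.exp (n * Real.log (1 - δ)) := by
      rw [Real.exp_nat_mul, Real.exp_log hpos]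
    rw [this, ← Real.exp_add]
    congr 1
    ring
  rw [h1] at h
  have h2 := mul_le_mul_of_nonneg_left hn.le (Real.exp_pos ((1 - δ) * n)).le
  linarith

/-- The left side is `exp y` times the generating function `E u ^ nonSingle X` of a Poisson variable
`X` of mean `y`. For small `y` the logarithm of that expectation is about `-(1 - u ^ 2) / 2 * y ^ 2`,
but it is only linear in `y` for large `y`; replacing `y ^ 2` by its tangent lines at points of a
bounded interval gives one bound valid for all `y`. -/
theorem exists_exp_add_le_exp {u K : ℝ} (hu0 : 0 < u) (hu1 : u < 1) (hK0 : 0 < K)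
    (hK : K < (1 - u ^ 2) / 2) :
    ∃ A > 0, ∀ y ≥ 0, ∀ s ≥ 0, s ≤ A →
      Real.exp (u * y) + (1 - u) * y ≤ Real.exp (y - K * (2 * s * y - s ^ 2)) := by
  have hw : 0 < 1 - u := by linarith
  set η := ((1 - u ^ 2) / 2 - K) / K with hη
  have hη0 : 0 < η := div_pos (by linarith) hK0
  have hηK : η * K = (1 - u ^ 2) / 2 - K := div_mul_cancel₀ _ hK0.ne'
  -- This `c` makes `(1 + u η) (1 - u - c) = 1 - u`, the condition needed for `y ≥ η`.
  set c := (1 - u) * (u * η) / (1 + u * η) with hc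
  have huη : 0 < u * η := mul_pos hu0 hη0
  have hc0 : 0 < c := by positivity
  have hcη : c * (1 + u * η) = (1 - u) * (u * η) := div_mul_cancel₀ _ (by positivity)
  refine ⟨c / (2 * K), by positivity, fun y hy s hs hsA => ?_⟩
  rcases le_total y η with h | h
  · -- For small `y`, expand to second order and use `2 s y - s ^ 2 ≤ y ^ 2`.
    have h1 : y - K * y ^ 2 ≤ y - K * (2 * s * y - s ^ 2) := by
      nlinarith [mul_nonneg hK0.le (sq_nonneg (y - s))]
    refine le_trans ?_ (Real.exp_le_exp.2 h1)
    set v := (1 - u) * y - K * y ^ 2 with hv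
    have hyK : y * K ≤ η * K := mul_le_mul_of_nonneg_right h hK0.le
    have hv1 : 0 ≤ (1 - u) - K * y := by nlinarith
    have hv0 : 0 ≤ v := by
      have := mul_nonneg hy hv1
      rw [hv]; linarith
    have h2 : Real.exp (y - K * y ^ 2) = Real.exp (u * y) * Real.exp v := by
      rw [← Real.exp_add]; congr 1; rw [hv]; ring
    have h3 := Real.quadratic_le_exp_of_nonneg hv0
    have h4 := Real.add_one_le_exp (u * y)
    have h5 : 0 ≤ u * y := by positivity
    have h6 : (1 - u) * y ≤ (u * y + 1) * (v + v ^ 2 / 2) := by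
      have e1 : 0 ≤ y ^ 2 * ((1 - u ^ 2) / 2 - K - y * K) :=
        mul_nonneg (sq_nonneg y) (by linarith)
      have e3 : (u * y + 1) * (v + v ^ 2 / 2) =
        (1 - u) * y + y ^ 2 * ((1 - u ^ 2) / 2 - K - y * K) + (K * y ^ 2) ^ 2 / 2 +
          u * y * (v ^ 2 / 2) := by
        rw [hv]; ring
      have e4 : 0 ≤ (K * y ^ 2) ^ 2 / 2 + u * y * (v ^ 2 / 2) := by positivity
      linarith
    rw [h2]
    have h7 : 0 ≤ v + v ^ 2 / 2 := by positivity
    have h8 := mul_le_mul_of_nonneg_right h4 h7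
    have h9 := mul_le_mul_of_nonneg_left h3 (Real.exp_pos (u * y)).le
    linarith
  · -- For large `y`, a linear lower bound on the exponent suffices.
    have h1 : (1 - c) * y ≤ y - K * (2 * s * y - s ^ 2) := by
      have h2 : s * (2 * K) ≤ c := by rwa [le_div_iff₀ (by positivity)] at hsA
      nlinarith [mul_le_mul_of_nonneg_right h2 hy, mul_nonneg hK0.le (sq_nonneg s)]
    refine le_trans ?_ (Real.exp_le_exp.2 h1)
    have h2 : Real.exp ((1 - c) * y) = Real.exp (u * y) * Real.exp ((1 - u - c) * y) := by
      rw [← Real.exp_add]; congr 1; ring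
    have h3 := Real.add_one_le_exp ((1 - u - c) * y)
    have h4 := Real.add_one_le_exp (u * y)
    have hcu : c * (1 + u * η) + (1 - u) = (1 - u) * (1 + u * η) := by rw [hcη]; ring
    have hcw : 0 ≤ 1 - u - c := by nlinarith
    have h5 : u * η ≤ u * y := mul_le_mul_of_nonneg_left h hu0.le
    have h6 : (1 - u) * y ≤ Real.exp (u * y) * ((1 - u - c) * y) := by
      calc (1 - u) * y = (1 + u * η) * ((1 - u - c) * y) := by linear_combination y * hcu
        _ ≤ _ := mul_le_mul_of_nonneg_right (by linarith) (mul_nonneg hcw hy)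
    rw [h2]
    have h9 := mul_le_mul_of_nonneg_left h3 (Real.exp_pos (u * y)).le
    linarith

/-! ### Uniform upper bound over the alternatives -/

/-- Since `q - p` has total mass zero, its mass on `B` is minus its mass on the complement of `B`. -/
theorem abs_sum_sub_le_of_sum_eq {m : ℕ} {q p : Fin m → ℝ} (h : ∑ j, q j = ∑ j, p j)
    (B : Finset (Fin m)) : 2 * |∑ j ∈ B, q j - ∑ j ∈ B, p j| ≤ ∑ j, |q j - p j| := by
  have h1 := Finset.sum_add_sum_compl B fun j => q j - p j
  have h2 := Finset.sum_add_sum_compl B fun j => |q j - p j|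
  have h3 := Finset.abs_sum_le_sum_abs (fun j => q j - p j) B
  have h4 := Finset.abs_sum_le_sum_abs (fun j => q j - p j) Bᶜ
  rw [Finset.sum_sub_distrib (s := Finset.univ), h, sub_self] at h1
  rw [← Finset.sum_sub_distrib]
  rw [eq_neg_of_add_eq_zero_right h1, abs_neg] at h4
  linarith

theorem sum_uniformPMF {m : ℕ} (hm : 0 < m) : ∑ j, uniformPMF m j = 1 := by
  have : (m : ℝ) ≠ 0 := by positivity
  simp [uniformPMF, this]

theorem two_mul_le_sum_abs_of_mem_alternatives {m : ℕ} (hm : 0 < m) {ε : ℝ} {q : Fin m → ℝ}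
    (hq : q ∈ alternatives m ε) : 2 * ε ≤ ∑ j, |q j - 1 / m| := by
  have h1 : tvDist q (uniformPMF m) ≤ (∑ j, |q j - 1 / m|) / 2 := by
    refine ciSup_le fun B => ?_
    have := abs_sum_sub_le_of_sum_eq (hq.1.2.trans (sum_uniformPMF hm).symm) B
    unfold uniformPMF at this ⊢
    linarith
  have h2 := hq.2
  linarith

/-- Lagrangian dual certificate for the minimum `kappaLow ε` of the mean of `x ^ 2` over nonnegative `x`
of mean `1` whose mean of `|x - 1|` is at least `2 * ε`. Every piece of the affine minorant is
below a tangent line `2 * s * x - s ^ 2` with bounded `s`, so that it also bounds functions that are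
quadratic only on a bounded interval. For `ε < 1 / 2` the points of contact are `1 ± 2 * ε`; for
`ε ≥ 1 / 2` they are `0` and `1 / (1 - ε)`. -/
theorem exists_tangent_certificate {ε : ℝ} (h0 : 0 < ε) (h1 : ε < 1) :
    ∃ α β γ s₀ : ℝ, 0 ≤ γ ∧ 0 ≤ s₀ ∧ α + β + γ * (2 * ε) = kappaLow ε ∧
      ∀ x ≥ 0, ∃ s ≥ 0, s ≤ s₀ ∧ α + β * x + γ * |x - 1| ≤ 2 * s * x - s ^ 2 := by
  unfold kappaLow
  split_ifs with h
  · refine ⟨-1 - 4 * ε ^ 2, 2, 4 * ε, 1 + 2 * ε, by positivity, by positivity, by ring,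
      fun x _ => ?_⟩
    rcases le_total 1 x with h | h
    · refine ⟨1 + 2 * ε, by positivity, le_rfl, ?_⟩
      rw [abs_of_nonneg (by linarith)]
      apply le_of_eq
      ring
    · refine ⟨1 - 2 * ε, by linarith, by linarith, ?_⟩
      rw [abs_of_nonpos (by linarith)]
      apply le_of_eq
      ring
  · have hε : 0 < 1 - ε := by linarith
    set a := 1 / (1 - ε) with ha
    have ha2 : 2 ≤ a := by rw [ha, le_div_iff₀ hε]; linarith
    have haε : a * (1 - ε) = 1 := div_mul_cancel₀ _ hε.ne'
    refine ⟨-(a ^ 2 / 2), 2 * a - a ^ 2 / 2, a ^ 2 / 2, a, by positivity, by positivity, ?_,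
      fun x hx => ?_⟩
    · have h2 : 1 + ε / (1 - ε) = a := by rw [ha]; field_simp; ring
      rw [h2]
      linear_combination (-a) * haε
    · rcases le_total 1 x with h | h
      · refine ⟨a, by linarith, le_rfl, ?_⟩
        rw [abs_of_nonneg (by linarith)]
        apply le_of_eq
        ring
      · refine ⟨0, le_rfl, by linarith, ?_⟩
        rw [abs_of_nonpos (by linarith)]
        nlinarith [mul_nonneg hx (mul_nonneg (by linarith : 0 ≤ a) (by linarith : 0 ≤ a - 2))]

/-- The smallness condition on `c / m` does not depend on `q`, even though `c * q j` may be large. -/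
theorem prod_le_exp_of_mem_alternatives {ε u K : ℝ} (h0 : 0 < ε) (h1 : ε < 1)
    (hu0 : 0 < u) (hu1 : u < 1) (hK0 : 0 < K) (hK : K < (1 - u ^ 2) / 2) :
    ∃ a > (0 : ℝ), ∀ m : ℕ, 0 < m → ∀ c ≥ (0 : ℝ), c / m ≤ a → ∀ q ∈ alternatives m ε,
      ∏ j, (Real.exp (u * (c * q j)) + (1 - u) * (c * q j)) ≤
        Real.exp (c - K * (kappaLow ε * (c ^ 2 / m))) := by
  obtain ⟨A, hA, hAle⟩ := exists_exp_add_le_exp hu0 hu1 hK0 hK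
  obtain ⟨α, β, γ, s₀, hγ, hs₀, hκ, hcert⟩ := exists_tangent_certificate h0 h1
  refine ⟨A / (s₀ + 1), by positivity, fun m hm c hc hca q hq => ?_⟩
  have hm' : (0 : ℝ) < m := by exact_mod_cast hm
  set μ := c / m with hμ
  have hμ0 : 0 ≤ μ := by positivity
  have hμA : μ * s₀ ≤ A := by
    rw [le_div_iff₀ (by positivity)] at hca
    linarith
  have hterm : ∀ j, Real.exp (u * (c * q j)) + (1 - u) * (c * q j) ≤
      Real.exp (c * q j - K * μ ^ 2 * (α + β * (m * q j) + γ * |m * q j - 1|)) := by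
    intro j
    have hqj := hq.1.1 j
    obtain ⟨s, hs, hss, hle⟩ := hcert (m * q j) (by positivity)
    refine (hAle (c * q j) (by positivity) (μ * s) (by positivity)
      ((mul_le_mul_of_nonneg_left hss hμ0).trans hμA)).trans (Real.exp_le_exp.2 ?_)
    have h2 : c * q j = μ * (m * q j) := by rw [hμ]; field_simp
    have h3 : K * (2 * (μ * s) * (c * q j) - (μ * s) ^ 2) =
        K * μ ^ 2 * (2 * s * (m * q j) - s ^ 2) := by rw [h2]; ring
    rw [h3]
    have h4 : 0 ≤ K * μ ^ 2 := by positivity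
    linarith [mul_le_mul_of_nonneg_left hle h4]
  have hpos : ∀ j, 0 ≤ Real.exp (u * (c * q j)) + (1 - u) * (c * q j) := fun j => by
    have := hq.1.1 j
    have : 0 ≤ 1 - u := by linarith
    positivity
  refine (Finset.prod_le_prod (fun j _ => hpos j) fun j _ => hterm j).trans ?_
  rw [← Real.exp_sum, Real.exp_le_exp, Finset.sum_sub_distrib, ← Finset.mul_sum, hq.1.2,
    ← Finset.mul_sum, Finset.sum_add_distrib, Finset.sum_add_distrib, ← Finset.mul_sum,
    ← Finset.mul_sum, ← Finset.mul_sum, hq.1.2]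
  have h2 : ∑ j, |m * q j - 1| = m * ∑ j, |q j - 1 / m| := by
    rw [Finset.mul_sum]
    refine Finset.sum_congr rfl fun j _ => ?_
    rw [← abs_of_pos hm', ← abs_mul, abs_of_pos hm']
    congr 1
    field_simp
  have h3 := two_mul_le_sum_abs_of_mem_alternatives hm hq
  have h4 : m * kappaLow ε ≤ m * α + β * m + γ * ∑ j, |m * q j - 1| := by
    rw [← hκ, h2]
    have := mul_le_mul_of_nonneg_left h3 (mul_nonneg hγ hm'.le)
    linarith
  have h5 : K * (kappaLow ε * (c ^ 2 / m)) = K * μ ^ 2 * (m * kappaLow ε) := by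
    rw [hμ]; field_simp
  rw [h5]
  have h6 := mul_le_mul_of_nonneg_left h4 (by positivity : 0 ≤ K * μ ^ 2)
  simp only [Finset.sum_const, Finset.card_univ, Fintype.card_fin, nsmul_eq_mul, mul_one]
  linarith

theorem one_le_kappaLow {ε : ℝ} (h1 : ε < 1) : 1 ≤ kappaLow ε := by
  unfold kappaLow
  have : 0 < 1 - ε := by linarith
  split_ifs with h
  · nlinarith [sq_nonneg ε]
  · have : 0 ≤ ε / (1 - ε) := div_nonneg (by linarith) this.le
    linarith

theorem eventually_iidExp_pow_collisionStat_le {m : ℕ → ℕ} (hm : ∀ᶠ n in atTop, 0 < m n)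
    (hnm : Tendsto (fun n : ℕ => (n : ℝ) / m n) atTop (𝓝 0))
    (hr : Tendsto (fun n : ℕ => (n : ℝ) ^ 2 / m n) atTop atTop)
    {ε u K : ℝ} (h0 : 0 < ε) (h1 : ε < 1) (hu0 : 0 < u) (hu1 : u < 1)
    (hK : K < (1 - u ^ 2) / 2) (hK0 : 0 < K) :
    ∀ᶠ n in atTop, ∀ q ∈ alternatives (m n) ε,
      iidExp (n := n) q (fun z => u ^ collisionStat z) ≤
        Real.exp (-(K * (kappaLow ε * ((n : ℝ) ^ 2 / m n)))) := by
  obtain ⟨L, hKL, hL⟩ := exists_between hK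
  -- Then `L (1 - δ) ^ 2 > K`, and the gap absorbs the constant factor of the Poisson comparison.
  set δ := (L - K) / (4 * L) with hδ
  have hL0 : 0 < L := hK0.trans hKL
  have hδ0 : 0 < δ := div_pos (by linarith) (by linarith)
  have hδ1 : δ < 1 := by rw [hδ, div_lt_one (by linarith)]; linarith
  have hδL : δ * (4 * L) = L - K := div_mul_cancel₀ _ (by positivity)
  have hgap : 0 < L * (1 - δ) ^ 2 - K := by nlinarith [mul_nonneg hL0.le (sq_nonneg δ)]
  obtain ⟨a, ha, hprod⟩ := prod_le_exp_of_mem_alternatives h0 h1 hu0 hu1 hL0 hL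
  have hκ := one_le_kappaLow h1
  filter_upwards [hm, hnm.eventually (gt_mem_nhds ha), eventually_half_exp_le_sum hδ0 hδ1,
    hr.eventually_ge_atTop (Real.log 2 / (L * (1 - δ) ^ 2 - K))] with n hmn hna hpoi hrn q hq
  have hδ' : 0 < 1 - δ := by linarith
  set c := (1 - δ) * (n : ℝ) with hc
  have hc0 : 0 ≤ c := by positivity
  have hcn : c / m n ≤ a := by
    refine le_trans (div_le_div_of_nonneg_right ?_ (Nat.cast_nonneg _)) hna.le
    nlinarith [Nat.cast_nonneg (α := ℝ) n]
  set E := iidExp (n := n) q (fun z => u ^ collisionStat z)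
  have hE0 : 0 ≤ E := Finset.sum_nonneg fun z _ =>
    mul_nonneg (Finset.prod_nonneg fun _ _ => hq.1.1 _) (pow_nonneg hu0.le _)
  have h2 : (∑ k ∈ Finset.range (n + 1), c ^ k / k.factorial) * E ≤
      Real.exp (c - L * (kappaLow ε * (c ^ 2 / m n))) := by
    refine le_trans ?_ ((sum_pow_div_factorial_mul_iidExp_le hq.1.1 hu0.le hu1.le hc0 n).trans
      (hprod (m n) hmn c hc0 hcn q hq))
    rw [Finset.sum_mul]
    refine Finset.sum_le_sum fun k hk => mul_le_mul_of_nonneg_left ?_ (by positivity)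
    exact antitone_iidExp_pow_collisionStat hq.1 hu0.le hu1.le
      (Nat.lt_succ_iff.1 (Finset.mem_range.1 hk))
  have h3 : Real.exp c / 2 * E ≤ Real.exp c * Real.exp (-(L * (kappaLow ε * (c ^ 2 / m n)))) := by
    rw [← Real.exp_add, ← sub_eq_add_neg]
    exact (mul_le_mul_of_nonneg_right hpoi hE0).trans h2
  have h4 : E ≤ 2 * Real.exp (-(L * (kappaLow ε * (c ^ 2 / m n)))) := by
    have := Real.exp_pos c
    rw [div_mul_eq_mul_div, mul_div_assoc] at h3
    linarith [le_of_mul_le_mul_left h3 this]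
  refine h4.trans ?_
  rw [← Real.exp_log (two_pos : (0 : ℝ) < 2), ← Real.exp_add, Real.exp_le_exp]
  rw [div_le_iff₀ hgap] at hrn
  have h5 : c ^ 2 / m n = (1 - δ) ^ 2 * ((n : ℝ) ^ 2 / m n) := by rw [hc]; ring
  rw [h5]
  set r := (n : ℝ) ^ 2 / m n
  have hr0 : 0 ≤ r := by positivity
  have h6 : r * (L * (1 - δ) ^ 2 - K) ≤ kappaLow ε * (r * (L * (1 - δ) ^ 2 - K)) :=
    le_mul_of_one_le_left (by positivity) hκ
  linarith

/-! ### Exponents, threshold and factorials -/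

/-- The exponent is determined by matching exponential bounds up to every `η > 0`. -/
theorem genErrorExponent_eq_coe {m : ℕ → ℕ} {P : ℕ → ℝ≥0∞} {J : ℝ}
    (hr : ∀ᶠ n : ℕ in atTop, 0 < (n : ℝ) ^ 2 / m n)
    (hub : ∀ η > 0, ∀ᶠ n : ℕ in atTop,
      P n ≤ ENNReal.ofReal (Real.exp (-((n : ℝ) ^ 2 / m n * (J - η)))))
    (hlb : ∀ η > 0, ∀ᶠ n : ℕ in atTop,
      ENNReal.ofReal (Real.exp (-((n : ℝ) ^ 2 / m n * (J + η)))) ≤ P n) :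
    genErrorExponent m P = J := by
  have hlog : ∀ r x : ℝ, 0 < r →
      ((1 / r : ℝ) : EReal) * ENNReal.log (ENNReal.ofReal (Real.exp (-(r * x)))) =
        ((-x : ℝ) : EReal) := by
    intro r x hr
    rw [ENNReal.log_ofReal_of_pos (Real.exp_pos _), Real.log_exp, ← EReal.coe_mul]
    congr 1
    field_simp
  have hlim : Tendsto (fun n : ℕ =>
      ((1 / ((n : ℝ) ^ 2 / (m n : ℝ)) : ℝ) : EReal) * ENNReal.log (P n)) atTop
      (𝓝 ((-J : ℝ) : EReal)) := by
    refine tendsto_order.2 ⟨fun a ha => ?_, fun a ha => ?_⟩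
    · obtain ⟨x, hax, hx⟩ := EReal.lt_iff_exists_real_btwn.1 ha
      have hx' : x < -J := EReal.coe_lt_coe_iff.1 hx
      filter_upwards [hr, hlb (-J - x) (by linarith)] with n hn h
      refine hax.trans_le ?_
      have h1 := hlog _ (J + (-J - x)) hn
      rw [show -(J + (-J - x)) = x by ring] at h1
      rw [← h1]
      exact mul_le_mul_of_nonneg_left (ENNReal.log_monotone h)
        (EReal.coe_nonneg.2 (by positivity))
    · obtain ⟨x, hx, hxa⟩ := EReal.lt_iff_exists_real_btwn.1 ha
      have hx' : -J < x := EReal.coe_lt_coe_iff.1 hx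
      filter_upwards [hr, hub (J + x) (by linarith)] with n hn h
      refine lt_of_le_of_lt ?_ hxa
      have h1 := hlog _ (J - (J + x)) hn
      rw [show -(J - (J + x)) = x by ring] at h1
      rw [← h1]
      exact mul_le_mul_of_nonneg_left (ENNReal.log_monotone h)
        (EReal.coe_nonneg.2 (by positivity))
  unfold genErrorExponent
  rw [hlim.limsup_eq, EReal.coe_neg, neg_neg]

theorem JFstar_eq {τ : ℝ} (hτ : 0 ≤ τ) :
    JFstar τ = ((((1 + τ) * Real.log (1 + τ) - τ) / 2 : ℝ) : EReal) := by
  have h1 : 0 < 1 + τ := by linarith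
  refine le_antisymm (iSup₂_le fun θ _ => EReal.coe_le_coe_iff.2 ?_) ?_
  · have h2 := Real.add_one_le_exp (2 * θ - Real.log (1 + τ))
    rw [Real.exp_sub, Real.exp_log h1, le_div_iff₀ h1] at h2
    linarith
  · refine le_iSup₂_of_le (Real.log (1 + τ) / 2)
      (div_nonneg (Real.log_nonneg (by linarith)) two_pos.le) (EReal.coe_le_coe_iff.2 ?_)
    rw [show 2 * (Real.log (1 + τ) / 2) = Real.log (1 + τ) by ring, Real.exp_log h1]
    apply le_of_eq
    ring

theorem JMstar_eq {ε τ : ℝ} (hτ : 0 ≤ τ) (hτκ : τ ≤ kappaLow ε - 1) :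
    JMstar ε τ = (((kappaLow ε - (1 + τ) - (1 + τ) * Real.log (kappaLow ε / (1 + τ))) / 2 : ℝ) :
      EReal) := by
  have h1 : 0 < 1 + τ := by linarith
  set κ := kappaLow ε with hκ
  have hκ0 : 0 < κ := by linarith
  refine le_antisymm (iSup₂_le fun θ _ => EReal.coe_le_coe_iff.2 ?_) ?_
  · have h2 := Real.add_one_le_exp (-2 * θ + Real.log (κ / (1 + τ)))
    rw [Real.exp_add, Real.exp_log (by positivity), mul_div_assoc', le_div_iff₀ h1] at h2
    rw [← hκ]
    linarith
  · refine le_iSup₂_of_le (Real.log (κ / (1 + τ)) / 2)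
      (div_nonneg (Real.log_nonneg ((one_le_div h1).2 (by linarith))) two_pos.le)
      (EReal.coe_le_coe_iff.2 ?_)
    rw [show -2 * (Real.log (κ / (1 + τ)) / 2) = -Real.log (κ / (1 + τ)) by ring, Real.exp_neg,
      Real.exp_log (by positivity), ← hκ]
    apply le_of_eq
    field_simp
    ring

theorem iidExp_comp_occurrences_succ {m n : ℕ} {q : Fin m → ℝ} (hq : ∑ j, q j = 1)
    (f : ℕ → ℝ) (j : Fin m) :
    iidExp (n := n + 1) q (fun z => f (occurrences z j)) =
      q j * iidExp (n := n) q (fun z => f (occurrences z j + 1)) +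
        (1 - q j) * iidExp (n := n) q (fun z => f (occurrences z j)) := by
  rw [iidExp_succ]
  unfold iidExp
  rw [Finset.mul_sum, Finset.mul_sum, ← Finset.sum_add_distrib]
  refine Finset.sum_congr rfl fun z _ => ?_
  have h : ∀ a, q a * f (occurrences (Fin.cons a z : Fin (n + 1) → Fin m) j) =
      q a * f (occurrences z j) +
        if a = j then q j * (f (occurrences z j + 1) - f (occurrences z j)) else 0 := by
    intro a
    rw [occurrences_cons]
    split_ifs with h
    · subst h; ring
    · simp
  dsimp only
  rw [Finset.sum_congr rfl fun a _ => h a, Finset.sum_add_distrib, ← Finset.sum_mul, hq]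
  simp only [Finset.sum_ite_eq', Finset.mem_univ, if_true]
  ring

theorem iidExp_occurrences_eq_zero {m : ℕ} {q : Fin m → ℝ} (hq : ∑ j, q j = 1) (j : Fin m)
    (n : ℕ) :
    iidExp (n := n) q (fun z => if occurrences z j = 0 then 1 else 0) = (1 - q j) ^ n := by
  induction n with
  | zero => simp [iidExp, occurrences]
  | succ n ih =>
    rw [iidExp_comp_occurrences_succ hq (fun k => if k = 0 then 1 else 0), ih]
    simp [iidExp]
    ring

theorem iidExp_occurrences_eq_one {m : ℕ} {q : Fin m → ℝ} (hq : ∑ j, q j = 1) (j : Fin m)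
    (n : ℕ) :
    iidExp (n := n) q (fun z => if occurrences z j = 1 then 1 else 0) =
      n * q j * (1 - q j) ^ (n - 1) := by
  induction n with
  | zero => simp [iidExp, occurrences]
  | succ n ih =>
    rw [iidExp_comp_occurrences_succ hq (fun k => if k = 1 then 1 else 0), ih]
    simp only [Nat.add_eq_right, Nat.add_sub_cancel]
    rw [iidExp_occurrences_eq_zero hq]
    rcases n with _ | n
    · simp
    · simp only [Nat.add_sub_cancel]
      push_cast
      ring

theorem iidExp_coincidenceStat {m n : ℕ} (hm : 0 < m) :
    iidExp (uniformPMF m) (coincidenceStat (m := m) (n := n)) =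
      -(n * (1 - 1 / (m : ℝ)) ^ (n - 1)) := by
  have hm' : (m : ℝ) ≠ 0 := by positivity
  have h : iidExp (uniformPMF m) (coincidenceStat (m := m) (n := n)) =
      -∑ j, iidExp (n := n) (uniformPMF m) (fun z => if occurrences z j = 1 then 1 else 0) := by
    unfold iidExp coincidenceStat
    rw [Finset.sum_comm, ← Finset.sum_neg_distrib]
    refine Finset.sum_congr rfl fun z _ => ?_
    rw [mul_neg, Finset.mul_sum]
  rw [h, Finset.sum_congr rfl fun j _ => iidExp_occurrences_eq_one (sum_uniformPMF hm) j n]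
  simp only [uniformPMF, Finset.sum_const, Finset.card_univ, Fintype.card_fin, nsmul_eq_mul]
  field_simp

/-- Seen through the number of observations in coincidences, the threshold is `(1 + τ) n ^ 2 / m` to
first order. -/
theorem tendsto_threshold {m : ℕ → ℕ} (hm : ∀ᶠ n in atTop, 0 < m n)
    (hnm : Tendsto (fun n : ℕ => (n : ℝ) / m n) atTop (𝓝 0)) {τ : ℝ} {τs : ℕ → ℝ}
    (hτs : Tendsto (fun n : ℕ => (m n : ℝ) * τs n / (n : ℝ) ^ 2) atTop (𝓝 τ)) :
    Tendsto (fun n : ℕ => (n + (iidExp (uniformPMF (m n))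
      (coincidenceStat (m := m n) (n := n)) + τs n)) / ((n : ℝ) ^ 2 / m n)) atTop
      (𝓝 (1 + τ)) := by
  have hinv : Tendsto (fun n : ℕ => 1 - 1 / (n : ℝ)) atTop (𝓝 1) := by
    simpa using tendsto_one_div_atTop_nhds_zero_nat.const_sub (1 : ℝ)
  have hmain : Tendsto (fun n : ℕ => ((m n : ℝ) / n) * (1 - (1 - 1 / (m n : ℝ)) ^ (n - 1)))
      atTop (𝓝 1) := by
    have hlow : Tendsto (fun n : ℕ => (1 - 1 / (n : ℝ)) / (1 + (n : ℝ) / m n)) atTop (𝓝 1) := by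
      have := hinv.div (hnm.const_add 1) (by norm_num)
      rwa [add_zero, div_one] at this
    refine tendsto_of_tendsto_of_tendsto_of_le_of_le' hlow hinv ?_ ?_
    all_goals
      filter_upwards [hm, eventually_gt_atTop 0] with n hmn hn
      have hmn' : (1 : ℝ) ≤ m n := by exact_mod_cast hmn
      have hn' : (0 : ℝ) < n := by exact_mod_cast hn
      obtain ⟨N, rfl⟩ := Nat.exists_eq_succ_of_ne_zero hn.ne'
      simp only [Nat.succ_eq_add_one, Nat.add_sub_cancel] at hn' ⊢
      have hx0 : 0 ≤ 1 / (m (N + 1) : ℝ) := by positivity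
      have hx1 : 1 / (m (N + 1) : ℝ) ≤ 1 := by rw [div_le_one (by linarith)]; exact hmn'
      set M := (m (N + 1) : ℝ) with hM
      have hM0 : 0 < M := by linarith
      have e1 : 1 - 1 / ((N + 1 : ℕ) : ℝ) = N / ((N + 1 : ℕ) : ℝ) := by
        push_cast; field_simp; ring
      rw [e1]
    · have h1 : (1 - 1 / M) ^ N * (1 + N * (1 / M)) ≤ 1 := by
        have h2 := one_add_mul_le_pow (a := 1 / M) (by linarith) N
        calc _ ≤ (1 - 1 / M) ^ N * (1 + 1 / M) ^ N :=
              mul_le_mul_of_nonneg_left h2 (pow_nonneg (by linarith) _)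
          _ = (1 - (1 / M) ^ 2) ^ N := by rw [← mul_pow]; congr 1; ring
          _ ≤ 1 := pow_le_one₀ (by nlinarith) (by nlinarith)
      have h3 : (N : ℝ) / (M + N) ≤ 1 - (1 - 1 / M) ^ N := by
        rw [div_le_iff₀ (by positivity)]
        have h4 : (1 + N * (1 / M)) * M = M + N := by field_simp
        have h5 := mul_le_mul_of_nonneg_right h1 hM0.le
        rw [mul_assoc, h4] at h5
        linarith
      have hN1 : (N : ℝ) ≤ ((N + 1 : ℕ) : ℝ) := by exact_mod_cast Nat.le_succ N
      calc (N : ℝ) / ((N + 1 : ℕ) : ℝ) / (1 + ((N + 1 : ℕ) : ℝ) / M)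
          = M / ((N + 1 : ℕ) : ℝ) * (N / (M + ((N + 1 : ℕ) : ℝ))) := by field_simp
        _ ≤ M / ((N + 1 : ℕ) : ℝ) * (N / (M + N)) := by gcongr
        _ ≤ _ := mul_le_mul_of_nonneg_left h3 (by positivity)
    · have h1 := one_add_mul_le_pow (a := -(1 / M)) (by linarith) N
      have h2 : 1 - (1 - 1 / M) ^ N ≤ N / M := by
        have : N * -(1 / M) = -(N / M) := by ring
        rw [this, ← sub_eq_add_neg, ← sub_eq_add_neg] at h1
        linarith
      refine (mul_le_mul_of_nonneg_left h2 (by positivity)).trans_eq ?_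
      field_simp
  refine (hmain.add hτs).congr' ?_
  filter_upwards [hm, eventually_gt_atTop 0] with n hmn hn
  rw [iidExp_coincidenceStat hmn]
  have h1 : (m n : ℝ) ≠ 0 := by positivity
  have h2 : (n : ℝ) ≠ 0 := by positivity
  field_simp
  ring

/-- An elementary form of Stirling's upper bound, exact up to a factor of order `√k`. -/
theorem factorial_le_exp (k : ℕ) :
    (k.factorial : ℝ) ≤ Real.exp ((k + 1) * Real.log (k + 1) - k) := by
  induction k with
  | zero => simp
  | succ k ih =>
    have hk : (0 : ℝ) < k + 1 := by positivity
    have hk2 : (0 : ℝ) < k + 2 := by positivity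
    have h1 := Real.one_sub_inv_le_log_of_pos (div_pos hk2 hk)
    rw [Real.log_div hk2.ne' hk.ne', inv_div] at h1
    have h2 : 1 ≤ (k + 2) * (Real.log (k + 2) - Real.log (k + 1)) := by
      have h3 : ((k : ℝ) + 2) * (1 - (k + 1) / (k + 2)) = 1 := by field_simp; ring
      exact h3.symm.trans_le (mul_le_mul_of_nonneg_left h1 hk2.le)
    rw [Nat.factorial_succ]
    push_cast
    calc ((k : ℝ) + 1) * k.factorial
        ≤ Real.exp (Real.log (k + 1)) * Real.exp ((k + 1) * Real.log (k + 1) - k) := by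
          rw [Real.exp_log hk]; gcongr
      _ ≤ _ := by
          rw [← Real.exp_add, Real.exp_le_exp, show (k : ℝ) + 1 + 1 = k + 2 by ring]
          linarith

/-! ### Asymptotic lower bound and extremal alternatives -/

/-- The exponent is the rate function of a Poisson variable of mean `κ r / 2` at `c r`, where
`r = n ^ 2 / m`. -/
theorem eventually_exp_le_iidProb {m : ℕ → ℕ} (hm : ∀ᶠ n in atTop, 0 < m n)
    (hnm : Tendsto (fun n : ℕ => (n : ℝ) / m n) atTop (𝓝 0))
    (hr : Tendsto (fun n : ℕ => (n : ℝ) ^ 2 / m n) atTop atTop)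
    {q : ∀ n, Fin (m n) → ℝ} (hq : ∀ᶠ n in atTop, q n ∈ stdSimplex ℝ (Fin (m n)))
    {C : ℝ} (hC : 0 ≤ C) (hqC : ∀ᶠ n in atTop, ∀ j, q n j ≤ C / m n)
    {κ : ℝ} (hκ : 0 < κ) (hqκ : Tendsto (fun n => m n * ∑ j, q n j ^ 2) atTop (𝓝 κ))
    {k : ℕ → ℕ} {c : ℝ} (hc : 0 < c)
    (hk : Tendsto (fun n : ℕ => (k n : ℝ) / ((n : ℝ) ^ 2 / m n)) atTop (𝓝 c))
    {η : ℝ} (hη : 0 < η) :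
    ∀ᶠ n : ℕ in atTop,
      Real.exp (-((n : ℝ) ^ 2 / m n * (κ / 2 - c - c * Real.log (κ / (2 * c)) + η))) ≤
        iidProb (q n) {z : Fin n → Fin (m n) | collisionStat z = 2 * k n} := by
  have hkn : Tendsto (fun n : ℕ => (k n : ℝ) / n) atTop (𝓝 0) := by
    have h := hk.mul hnm
    rw [mul_zero] at h
    refine h.congr' ?_
    filter_upwards [hm, eventually_gt_atTop 0] with n hmn hn
    have h1 : (m n : ℝ) ≠ 0 := by positivity
    have h2 : (n : ℝ) ≠ 0 := by positivity
    field_simp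
  set ρ : ℕ → ℝ := fun n =>
    (1 - 2 * ((k n : ℝ) / n)) ^ 2 * (m n * ∑ j, q n j ^ 2 - C ^ 2 * ((n : ℝ) / m n)) / 2
  have hρ : Tendsto ρ atTop (𝓝 (κ / 2)) := by
    have h := ((((hkn.const_mul 2).const_sub 1).pow 2).mul
      (hqκ.sub (hnm.const_mul (C ^ 2)))).div_const 2
    simpa using h
  set ω : ℕ → ℝ := fun n =>
    (m n * ∑ j, q n j ^ 2) / (2 * (1 - 2 * (C * ((n : ℝ) / m n))))
  have hω : Tendsto ω atTop (𝓝 (κ / 2)) := by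
    have h := hqκ.div ((((hnm.const_mul C).const_mul 2).const_sub 1).const_mul 2) (by norm_num)
    rwa [mul_zero, mul_zero, sub_zero, mul_one] at h
  have hrinv := hr.inv_tendsto_atTop
  have hk1 : Tendsto (fun n : ℕ => ((k n : ℝ) + 1) / ((n : ℝ) ^ 2 / m n)) atTop (𝓝 c) := by
    have h := hk.add hrinv
    rw [add_zero] at h
    refine h.congr fun n => ?_
    rw [add_div, Pi.inv_apply, one_div]
  have hk1top : Tendsto (fun n : ℕ => (k n : ℝ) + 1) atTop atTop := by
    have h := hk1.pos_mul_atTop hc hr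
    refine h.congr' ?_
    filter_upwards [hr.eventually_gt_atTop 0] with n hn
    exact div_mul_cancel₀ _ hn.ne'
  have hlogk : Tendsto (fun n : ℕ => Real.log ((k n : ℝ) + 1) / ((n : ℝ) ^ 2 / m n)) atTop
      (𝓝 0) := by
    have h := (Real.isLittleO_log_id_atTop.tendsto_div_nhds_zero.comp hk1top).mul hk1
    rw [zero_mul] at h
    refine h.congr fun n => ?_
    have h2 : (k n : ℝ) + 1 ≠ 0 := by positivity
    simp only [Function.comp, id]
    rw [div_mul_div_comm, mul_comm, mul_div_mul_left _ _ h2]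
  have hL : Tendsto (fun n : ℕ =>
      (k n : ℝ) / ((n : ℝ) ^ 2 / m n) *
          Real.log (ρ n / (((k n : ℝ) + 1) / ((n : ℝ) ^ 2 / m n))) -
        Real.log ((k n : ℝ) + 1) / ((n : ℝ) ^ 2 / m n) + (k n : ℝ) / ((n : ℝ) ^ 2 / m n) - ω n)
      atTop (𝓝 (c * Real.log (κ / 2 / c) - 0 + c - κ / 2)) :=
    (((hk.mul ((hρ.div hk1 hc.ne').log (by positivity))).sub hlogk).add hk).sub hω
  have hsmall : Tendsto (fun n : ℕ => 2 * (C * ((n : ℝ) / m n))) atTop (𝓝 0) := by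
    simpa using (hnm.const_mul C).const_mul 2
  have hkey : Tendsto (fun n => m n * ∑ j, q n j ^ 2 - C ^ 2 * ((n : ℝ) / m n)) atTop
      (𝓝 κ) := by simpa using hqκ.sub (hnm.const_mul (C ^ 2))
  filter_upwards [hm, hq, hqC, eventually_gt_atTop 0, hr.eventually_gt_atTop 0,
    hρ.eventually (lt_mem_nhds (half_pos hκ)), hkey.eventually (lt_mem_nhds hκ),
    hsmall.eventually (gt_mem_nhds one_pos),
    hkn.eventually (gt_mem_nhds (by norm_num : (0 : ℝ) < 1 / 2)),
    hL.eventually (lt_mem_nhds (show c * Real.log (κ / 2 / c) - 0 + c - κ / 2 - η < _ by linarith))]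
    with n hmn hqn hqCn hn hrn hρn hkeyn hsm hk2 hLn
  have hm0 : (0 : ℝ) < m n := by exact_mod_cast hmn
  have hn0 : (0 : ℝ) < n := by exact_mod_cast hn
  have hk2n : 2 * k n ≤ n := by
    rw [div_lt_iff₀ hn0] at hk2
    have : (2 * k n : ℝ) ≤ n := by linarith
    exact_mod_cast this
  obtain ⟨l, hl⟩ := Nat.exists_eq_add_of_le' hk2n
  have hlR : (l : ℝ) = n * (1 - 2 * (k n / n)) := by
    have : (n : ℝ) = l + 2 * k n := by exact_mod_cast hl
    field_simp
    linarith
  have hnb : (n : ℝ) * (C / m n) = C * (n / m n) := by ring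
  have hnb2 : (n : ℝ) * (C / m n) ^ 2 = C ^ 2 * (n / m n) / m n := by ring
  have hlb := le_iidProb_collisionStat_eq (n := n) (l := l) (k := k n) hqn hqCn (by positivity)
    (by rw [hnb]; exact hsm) hl (by
      rw [hnb2, div_le_iff₀ hm0]; linarith)
  refine le_trans ?_ hlb
  have hbase : (l : ℝ) ^ 2 * (∑ j, q n j ^ 2 - n * (C / m n) ^ 2) / 2 =
      (n : ℝ) ^ 2 / m n * ρ n := by
    rw [hlR, hnb2]
    simp only [ρ]
    field_simp
  have hexp : (∑ j, q n j ^ 2) * (n : ℝ) ^ 2 / (2 * (1 - 2 * (n * (C / m n)))) =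
      (n : ℝ) ^ 2 / m n * ω n := by
    rw [hnb]
    simp only [ω]
    have e : (∑ j, q n j ^ 2) * (n : ℝ) ^ 2 =
        (n : ℝ) ^ 2 / m n * (m n * ∑ j, q n j ^ 2) := by field_simp
    rw [e, mul_div_assoc]
  rw [hbase, hexp]
  set r := (n : ℝ) ^ 2 / m n
  have hkp : (0 : ℝ) < k n + 1 := by positivity
  have hpow : (r * ρ n) ^ k n = Real.exp (k n * Real.log (r * ρ n)) := by
    rw [Real.exp_nat_mul, Real.exp_log (by positivity)]
  have hdiv : Real.exp (k n * Real.log (r * ρ n)) /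
      Real.exp ((k n + 1) * Real.log (k n + 1) - k n) ≤
        (r * ρ n) ^ k n / (k n).factorial := by
    rw [hpow]
    exact div_le_div_of_nonneg_left (Real.exp_pos _).le (by positivity) (factorial_le_exp _)
  refine le_trans ?_ (mul_le_mul_of_nonneg_right hdiv (Real.exp_pos _).le)
  rw [← Real.exp_sub, ← Real.exp_add, Real.exp_le_exp]
  have hlog : Real.log (ρ n / (((k n : ℝ) + 1) / r)) =
      Real.log (r * ρ n) - Real.log (k n + 1) := by
    rw [← Real.log_div (by positivity) (by positivity)]
    congr 1
    field_simp
  rw [hlog, div_div] at hLn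
  have h5 := mul_lt_mul_of_pos_left hLn hrn
  have h6 : r * ((k n : ℝ) / r * (Real.log (r * ρ n) - Real.log (k n + 1)) -
      Real.log (k n + 1) / r + k n / r - ω n) =
      k n * (Real.log (r * ρ n) - Real.log (k n + 1)) - Real.log (k n + 1) + k n - r * ω n := by
    field_simp
  rw [h6] at h5
  linarith

theorem iidProb_mono {m n : ℕ} {q : Fin m → ℝ} (hq : ∀ j, 0 ≤ q j) {A B : Set (Fin n → Fin m)}
    (h : A ⊆ B) : iidProb q A ≤ iidProb q B := by
  unfold iidProb
  refine Finset.sum_le_sum fun z _ => ?_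
  have hp : 0 ≤ ∏ i, q (z i) := Finset.prod_nonneg fun _ _ => hq _
  by_cases hz : z ∈ A
  · rw [if_pos hz, if_pos (h hz)]
  · rw [if_neg hz]
    split_ifs <;> simp [hp]

theorem iidProb_le_one {m n : ℕ} {q : Fin m → ℝ} (hq : q ∈ stdSimplex ℝ (Fin m))
    (A : Set (Fin n → Fin m)) : iidProb q A ≤ 1 := by
  refine (iidProb_le_iidExp hq.1 (W := fun _ => 1) (fun _ => zero_le_one)
    fun _ _ => le_rfl).trans_eq ?_
  have h := Finset.prod_univ_sum (fun _ : Fin n => Finset.univ) fun _ j => q j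
  simp only [hq.2, Finset.prod_const_one, Fintype.piFinset_univ] at h
  simp [iidExp, ← h]

theorem uniformPMF_mem_stdSimplex {m : ℕ} (hm : 0 < m) : uniformPMF m ∈ stdSimplex ℝ (Fin m) :=
  ⟨uniformPMF_nonneg, sum_uniformPMF hm⟩

/-- The p.m.f. that exceeds the uniform one by a total mass `d` spread evenly over the first `b`
symbols, and falls short of it by the same mass spread evenly over the other symbols. -/
noncomputable def twoLevel (m b : ℕ) (d : ℝ) (j : Fin m) : ℝ :=
  if j.val < b then 1 / m + d / b else 1 / m - d / (m - b)

theorem sum_ite_val_lt {m b : ℕ} (hb : b ≤ m) (x y : ℝ) :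
    ∑ j : Fin m, (if j.val < b then x else y) = b * x + (m - b) * y := by
  obtain ⟨l, rfl⟩ := Nat.exists_eq_add_of_le hb
  rw [Fin.sum_univ_add]
  simp

theorem twoLevel_mem_alternatives {m b : ℕ} (hb : 0 < b) (hbm : b < m) {d ε : ℝ} (hε : 0 ≤ ε)
    (hεd : ε ≤ d) (hd : d ≤ 1 - b / m) : twoLevel m b d ∈ alternatives m ε := by
  have hb0 : (0 : ℝ) < b := by exact_mod_cast hb
  have hbm0 : (b : ℝ) < m := by exact_mod_cast hbm
  have hmb : (0 : ℝ) < m - b := by linarith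
  have hm0 : (0 : ℝ) < m := by linarith
  have hd0 : 0 ≤ d := hε.trans hεd
  refine ⟨⟨fun j => ?_, ?_⟩, hεd.trans ?_⟩
  · unfold twoLevel
    split_ifs
    · positivity
    · rw [sub_nonneg, div_le_div_iff₀ hmb hm0]
      have : (1 - (b : ℝ) / m) * m = m - b := by field_simp
      nlinarith
  · unfold twoLevel
    rw [sum_ite_val_lt hbm.le]
    field_simp
    ring
  · have hbdd : BddAbove (Set.range fun B : Finset (Fin m) =>
        |∑ j ∈ B, twoLevel m b d j - ∑ j ∈ B, uniformPMF m j|) := (Set.finite_range _).bddAbove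
    refine le_trans (le_of_eq ?_)
      (le_ciSup hbdd (Finset.univ.filter fun j : Fin m => j.val < b))
    rw [← Finset.sum_sub_distrib, Finset.sum_filter]
    have h : ∀ j : Fin m, (if j.val < b then twoLevel m b d j - uniformPMF m j else 0) =
        if j.val < b then d / b else 0 := by
      intro j
      unfold twoLevel uniformPMF
      split_ifs <;> ring
    rw [Finset.sum_congr rfl fun j _ => h j, sum_ite_val_lt hbm.le, mul_zero, add_zero,
      mul_div_cancel₀ _ hb0.ne', abs_of_nonneg hd0]

theorem mul_sum_twoLevel_sq {m b : ℕ} (hb : 0 < b) (hbm : b < m) (d : ℝ) :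
    m * ∑ j, twoLevel m b d j ^ 2 =
      1 + d ^ 2 * (((b : ℝ) / m)⁻¹ + (1 - (b : ℝ) / m)⁻¹) := by
  have hb0 : (0 : ℝ) < b := by exact_mod_cast hb
  have hbm0 : (b : ℝ) < m := by exact_mod_cast hbm
  have hmb : (m : ℝ) - b ≠ 0 := by linarith
  have hm0 : (0 : ℝ) < m := by linarith
  have h : ∀ j, twoLevel m b d j ^ 2 =
      if j.val < b then (1 / (m : ℝ) + d / b) ^ 2 else (1 / (m : ℝ) - d / (m - b)) ^ 2 := by
    intro j
    unfold twoLevel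
    split_ifs <;> rfl
  have h2 : 1 - (b : ℝ) / m = (m - b) / m := by field_simp
  rw [Finset.sum_congr rfl fun j _ => h j, sum_ite_val_lt hbm.le, h2]
  field_simp
  ring

theorem twoLevel_le {m b : ℕ} (hb : 0 < b) (hbm : b < m) {d : ℝ} (hd0 : 0 ≤ d) (hd : d ≤ 1)
    (j : Fin m) : twoLevel m b d j ≤ (1 + ((b : ℝ) / m)⁻¹) / m := by
  have hb0 : (0 : ℝ) < b := by exact_mod_cast hb
  have hbm0 : (b : ℝ) < m := by exact_mod_cast hbm
  have hm0 : (0 : ℝ) < m := by linarith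
  have h1 : (1 + ((b : ℝ) / m)⁻¹) / m = 1 / m + 1 / b := by field_simp
  rw [h1]
  unfold twoLevel
  split_ifs
  · gcongr
  · have h2 : 0 ≤ d / (m - b) := div_nonneg hd0 (by linarith)
    have h3 : 0 < 1 / (b : ℝ) := by positivity
    linarith

/-- The excess mass `ε` sits on half of the symbols if `ε < 1 / 2`; otherwise the p.m.f. is uniform on
a fraction close to `1 - ε` of the symbols. -/
theorem exists_extremal_alternatives {m : ℕ → ℕ} (hm : Tendsto m atTop atTop) {ε : ℝ}
    (h0 : 0 < ε) (h1 : ε < 1) :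
    ∃ q : ∀ n, Fin (m n) → ℝ, ∃ C ≥ (0 : ℝ), (∀ᶠ n in atTop, q n ∈ alternatives (m n) ε) ∧
      (∀ᶠ n in atTop, ∀ j, q n j ≤ C / m n) ∧
      Tendsto (fun n => m n * ∑ j, q n j ^ 2) atTop (𝓝 (kappaLow ε)) := by
  have hmR : Tendsto (fun n => (m n : ℝ)) atTop atTop := tendsto_natCast_atTop_atTop.comp hm
  -- The fraction `β` of symbols with increased mass and the excess mass `d`.
  obtain ⟨β, hβ0, hβ1, d, δ, hd, hdε, hδ⟩ : ∃ β : ℝ, 0 < β ∧ β < 1 ∧ ∃ (d : ℝ → ℝ) (δ : ℝ),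
      Tendsto d (𝓝 β) (𝓝 δ) ∧ (∀ x, 0 ≤ x → x ≤ β → ε ≤ d x ∧ d x ≤ 1 - x) ∧
      1 + δ ^ 2 * (β⁻¹ + (1 - β)⁻¹) = kappaLow ε := by
    unfold kappaLow
    split_ifs with h
    · refine ⟨1 / 2, by norm_num, by norm_num, fun _ => ε, ε, tendsto_const_nhds,
        fun x _ hx => ⟨le_rfl, by linarith⟩, ?_⟩
      norm_num
      ring
    · refine ⟨1 - ε, by linarith, by linarith, fun x => 1 - x, ε, ?_,
        fun x _ hx => ⟨by linarith, le_rfl⟩, ?_⟩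
      · have : Continuous fun x : ℝ => 1 - x := by fun_prop
        simpa using this.tendsto (1 - ε)
      · have : 1 - ε ≠ 0 := by linarith
        rw [sub_sub_cancel]
        field_simp
        ring
  set b : ℕ → ℕ := fun n => ⌊β * (m n : ℝ)⌋₊ with hbdef
  have hb : Tendsto (fun n => (b n : ℝ) / m n) atTop (𝓝 β) :=
    (tendsto_nat_floor_mul_div_atTop hβ0.le).comp hmR
  have hev : ∀ᶠ n in atTop, 0 < b n ∧ b n < m n ∧ (b n : ℝ) / m n ≤ β ∧ β / 2 < (b n : ℝ) / m n := by
    filter_upwards [hm.eventually_gt_atTop 0, hb.eventually (lt_mem_nhds (half_lt_self hβ0))]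
      with n hmn hbn
    have hm0 : (0 : ℝ) < m n := by exact_mod_cast hmn
    have hle : (b n : ℝ) ≤ β * m n := Nat.floor_le (by positivity)
    refine ⟨?_, ?_, (div_le_iff₀ hm0).2 hle, hbn⟩
    · by_contra hneg
      have : b n = 0 := by omega
      rw [this] at hbn
      simp at hbn
      linarith
    · have : (b n : ℝ) < m n := by nlinarith
      exact_mod_cast this
  refine ⟨fun n => twoLevel (m n) (b n) (d (b n / m n)), 1 + (β / 2)⁻¹, by positivity, ?_, ?_, ?_⟩
  · filter_upwards [hev] with n ⟨e1, e2, e3, e4⟩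
    obtain ⟨f1, f2⟩ := hdε _ (by positivity) e3
    exact twoLevel_mem_alternatives e1 e2 h0.le f1 f2
  · filter_upwards [hev] with n ⟨e1, e2, e3, e4⟩ j
    obtain ⟨f1, f2⟩ := hdε _ (by positivity) e3
    have h3 : (0 : ℝ) ≤ (b n : ℝ) / m n := by positivity
    refine (twoLevel_le e1 e2 (h0.le.trans f1) (by linarith) j).trans ?_
    gcongr
  · have hlim : Tendsto (fun n => 1 + d ((b n : ℝ) / m n) ^ 2 *
        (((b n : ℝ) / m n)⁻¹ + (1 - (b n : ℝ) / m n)⁻¹)) atTop (𝓝 (kappaLow ε)) := by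
      rw [← hδ]
      exact (((hd.comp hb).pow 2).mul ((hb.inv₀ hβ0.ne').add
        ((hb.const_sub 1).inv₀ (by linarith)))).const_add 1
    refine hlim.congr' ?_
    filter_upwards [hev] with n ⟨e1, e2, _, _⟩
    exact (mul_sum_twoLevel_sq e1 e2 _).symm

theorem tendsto_ceil_half_div {r t : ℕ → ℝ} (hr : Tendsto r atTop atTop) {a : ℝ} (ha : 0 < a)
    (ht : Tendsto (fun n => t n / r n) atTop (𝓝 a)) :
    Tendsto (fun n => (⌈t n / 2⌉₊ : ℝ) / r n) atTop (𝓝 (a / 2)) := by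
  have h1 : Tendsto (fun n => t n / r n / 2 + (r n)⁻¹) atTop (𝓝 (a / 2)) := by
    simpa using (ht.div_const 2).add hr.inv_tendsto_atTop
  refine tendsto_of_tendsto_of_tendsto_of_le_of_le' (ht.div_const 2) h1 ?_ ?_
  all_goals
    filter_upwards [hr.eventually_gt_atTop 0, ht.eventually (lt_mem_nhds ha)] with n hn htn
    have ht0 : 0 < t n := (div_pos_iff_of_pos_right hn).1 htn
    rw [div_right_comm]
  · exact div_le_div_of_nonneg_right (Nat.le_ceil _) hn.le
  · rw [← one_div, ← add_div]
    exact div_le_div_of_nonneg_right (Nat.ceil_lt_add_one (by positivity)).le hn.le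

/-! ### The coincidence-based test -/

theorem setOf_coincidenceTest_eq_one (m : ℕ → ℕ) (τs : ℕ → ℝ) (n : ℕ) :
    {z | coincidenceTest m τs n z = 1} = {z : Fin n → Fin (m n) |
      n + (iidExp (uniformPMF (m n)) (coincidenceStat (m := m n) (n := n)) + τs n) ≤
        collisionStat z} := by
  ext z
  simp only [Set.mem_ofPred_eq, coincidenceTest, coincidenceStat_eq z]
  split_ifs with h
  · simp only [true_iff]; linarith
  · simp only [zero_ne_one, false_iff, not_le]; linarith

theorem setOf_coincidenceTest_eq_zero (m : ℕ → ℕ) (τs : ℕ → ℝ) (n : ℕ) :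
    {z | coincidenceTest m τs n z = 0} = {z : Fin n → Fin (m n) | (collisionStat z : ℝ) <
      n + (iidExp (uniformPMF (m n)) (coincidenceStat (m := m n) (n := n)) + τs n)} := by
  ext z
  simp only [Set.mem_ofPred_eq, coincidenceTest, coincidenceStat_eq z]
  split_ifs with h
  · simp only [one_ne_zero, false_iff, not_lt]; linarith
  · simp only [true_iff]; linarith

theorem exponentF_coincidenceTest {m : ℕ → ℕ} (hm : ∀ᶠ n in atTop, 0 < m n)
    (hnm : Tendsto (fun n : ℕ => (n : ℝ) / m n) atTop (𝓝 0))
    (hr : Tendsto (fun n : ℕ => (n : ℝ) ^ 2 / m n) atTop atTop) {τ : ℝ} (hτ : 0 ≤ τ)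
    {τs : ℕ → ℝ}
    (hτs : Tendsto (fun n : ℕ => (m n : ℝ) * τs n / (n : ℝ) ^ 2) atTop (𝓝 τ)) :
    exponentF (coincidenceTest m τs) = JFstar τ := by
  have hτ1 : 0 < 1 + τ := by linarith
  have ht := tendsto_threshold hm hnm hτs
  rw [JFstar_eq hτ]
  unfold exponentF falseAlarm
  simp only [setOf_coincidenceTest_eq_one]
  set t : ℕ → ℝ := fun n =>
    n + (iidExp (uniformPMF (m n)) (coincidenceStat (m := m n) (n := n)) + τs n)
  refine genErrorExponent_eq_coe (hr.eventually_gt_atTop 0) (fun η hη => ?_) (fun η hη => ?_)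
  · -- The maximizer in `JFstar τ`.
    set θ := Real.log (1 + τ) / 2 with hθ
    have hθ0 : 0 ≤ θ := div_nonneg (Real.log_nonneg (by linarith)) two_pos.le
    have hθe : Real.exp (2 * θ) = 1 + τ := by
      rw [hθ, mul_div_cancel₀ _ (two_ne_zero), Real.exp_log hτ1]
    filter_upwards [hm, hr.eventually_gt_atTop 0, (ht.const_mul θ).eventually
      (lt_mem_nhds (show θ * (1 + τ) - η < _ by linarith))] with n hmn hrn htn
    refine ENNReal.ofReal_le_ofReal ((iidProb_uniform_le_exp hmn hθ0 (t n)).trans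
      (Real.exp_le_exp.2 ?_))
    have h1 := mul_lt_mul_of_pos_left htn hrn
    have h2 : (n : ℝ) ^ 2 / m n * (θ * (t n / ((n : ℝ) ^ 2 / m n))) = θ * t n := by
      rw [mul_left_comm, mul_div_cancel₀ _ hrn.ne']
    have h3 : (n : ℝ) ^ 2 / (2 * m n) = (n : ℝ) ^ 2 / m n / 2 := by rw [div_div, mul_comm 2]
    have h4 : Real.log (1 + τ) = 2 * θ := by rw [hθ]; ring
    rw [h2] at h1
    rw [hθe, h3, h4]
    linarith
  · have hk := tendsto_ceil_half_div hr hτ1 ht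
    have hone : Tendsto (fun n => m n * ∑ j, uniformPMF (m n) j ^ 2) atTop (𝓝 1) := by
      refine tendsto_const_nhds.congr' ?_
      filter_upwards [hm] with n hmn
      have : (m n : ℝ) ≠ 0 := by positivity
      simp only [uniformPMF, Finset.sum_const, Finset.card_univ, Fintype.card_fin, nsmul_eq_mul]
      field_simp
    have hlb := eventually_exp_le_iidProb hm hnm hr (q := fun n => uniformPMF (m n))
      (hm.mono fun n hmn => uniformPMF_mem_stdSimplex hmn) zero_le_one
      (Eventually.of_forall fun n j => le_rfl) one_pos hone (half_pos hτ1) hk hη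
    filter_upwards [hlb] with n hn
    have hJ : 1 / 2 - (1 + τ) / 2 - (1 + τ) / 2 * Real.log (1 / (2 * ((1 + τ) / 2))) =
        ((1 + τ) * Real.log (1 + τ) - τ) / 2 := by
      rw [mul_div_cancel₀ _ (two_ne_zero), one_div (1 + τ), Real.log_inv]
      ring
    rw [hJ] at hn
    refine ENNReal.ofReal_le_ofReal (hn.trans (iidProb_mono uniformPMF_nonneg ?_))
    intro z hz
    have hz' : collisionStat z = 2 * ⌈t n / 2⌉₊ := hz
    have h1 := Nat.le_ceil (t n / 2)
    simp only [Set.mem_ofPred_eq, hz']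
    push_cast
    linarith

theorem eventually_missedDetection_le {m : ℕ → ℕ} (hm : ∀ᶠ n in atTop, 0 < m n)
    (hnm : Tendsto (fun n : ℕ => (n : ℝ) / m n) atTop (𝓝 0))
    (hr : Tendsto (fun n : ℕ => (n : ℝ) ^ 2 / m n) atTop atTop) {ε : ℝ} (h0 : 0 < ε)
    (h1 : ε < 1) {τ : ℝ} (hτ : 0 ≤ τ) (hτκ : τ ≤ kappaLow ε - 1) {t : ℕ → ℝ}
    (ht : Tendsto (fun n : ℕ => t n / ((n : ℝ) ^ 2 / m n)) atTop (𝓝 (1 + τ)))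
    {η : ℝ} (hη : 0 < η) :
    ∀ᶠ n : ℕ in atTop, ∀ q ∈ alternatives (m n) ε,
      iidProb q {z : Fin n → Fin (m n) | (collisionStat z : ℝ) < t n} ≤
        Real.exp (-((n : ℝ) ^ 2 / m n * ((kappaLow ε - (1 + τ) -
          (1 + τ) * Real.log (kappaLow ε / (1 + τ))) / 2 - η))) := by
  have hτ1 : 0 < 1 + τ := by linarith
  have hκ := one_le_kappaLow h1
  set κ := kappaLow ε with hκdef
  have hκ0 : 0 < κ := by linarith
  rcases eq_or_lt_of_le hτκ with heq | hlt
  · -- The exponent vanishes, and a probability is at most one.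
    have hκτ : κ = 1 + τ := by linarith
    filter_upwards [hr.eventually_gt_atTop 0] with n hrn q hq
    refine (iidProb_le_one hq.1 _).trans (Real.one_le_exp ?_)
    rw [hκτ, div_self hτ1.ne', Real.log_one]
    have := mul_pos hrn hη
    linarith
  · -- The maximizer in `JMstar ε τ`.
    set θ := Real.log (κ / (1 + τ)) / 2 with hθ
    have hθ0 : 0 < θ := div_pos (Real.log_pos ((one_lt_div hτ1).2 (by linarith))) two_pos
    set u := Real.exp (-θ) with hu
    have hu0 : 0 < u := Real.exp_pos _
    have hu1 : u < 1 := Real.exp_lt_one_iff.2 (by linarith)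
    have hu2 : u ^ 2 = (1 + τ) / κ := by
      rw [hu, ← Real.exp_nat_mul, hθ]
      rw [show ((2 : ℕ) : ℝ) * -(Real.log (κ / (1 + τ)) / 2) = -Real.log (κ / (1 + τ)) by
        push_cast; ring, Real.exp_neg, Real.exp_log (by positivity), inv_div]
    have hu2' : κ * u ^ 2 = 1 + τ := by rw [hu2]; field_simp
    obtain ⟨K, hKlow, hK⟩ : ∃ K, max 0 ((1 - u ^ 2) / 2 - η / (2 * κ)) < K ∧
        K < (1 - u ^ 2) / 2 := by
      refine exists_between (max_lt ?_ ?_)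
      · nlinarith
      · have : 0 < η / (2 * κ) := by positivity
        linarith
    rw [max_lt_iff] at hKlow
    filter_upwards [eventually_iidExp_pow_collisionStat_le hm hnm hr h0 h1 hu0 hu1 hK hKlow.1,
      hr.eventually_gt_atTop 0, (ht.const_mul θ).eventually
      (gt_mem_nhds (show _ < θ * (1 + τ) + η / 2 by linarith))] with n hE hrn htn q hq
    set r := (n : ℝ) ^ 2 / m n
    have h2 : iidProb q {z : Fin n → Fin (m n) | (collisionStat z : ℝ) < t n} ≤
        Real.exp (θ * t n) * iidExp (n := n) q (fun z => u ^ collisionStat z) := by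
      have h3 : Real.exp (θ * t n) * iidExp (n := n) q (fun z => u ^ collisionStat z) =
          iidExp (n := n) q (fun z => Real.exp (θ * t n) * u ^ collisionStat z) := by
        unfold iidExp
        rw [Finset.mul_sum]
        exact Finset.sum_congr rfl fun _ _ => by ring
      rw [h3]
      refine iidProb_le_iidExp hq.1.1 (fun z => by positivity) fun z hz => ?_
      rw [hu, ← Real.exp_nat_mul, ← Real.exp_add]
      refine Real.one_le_exp ?_
      have hz' : (collisionStat z : ℝ) < t n := hz
      nlinarith
    refine h2.trans ((mul_le_mul_of_nonneg_left (hE q hq) (Real.exp_pos _).le).trans ?_)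
    rw [← Real.exp_add, Real.exp_le_exp]
    have h4 := mul_lt_mul_of_pos_left htn hrn
    have h5 : r * (θ * (t n / r)) = θ * t n := by
      rw [mul_left_comm, mul_div_cancel₀ _ hrn.ne']
    rw [h5] at h4
    have h6 : κ * ((1 - u ^ 2) / 2 - η / (2 * κ)) ≤ κ * K :=
      mul_le_mul_of_nonneg_left hKlow.2.le hκ0.le
    have h7 : κ * ((1 - u ^ 2) / 2 - η / (2 * κ)) = (κ - (1 + τ)) / 2 - η / 2 := by
      rw [← hu2']
      field_simp
    rw [h7] at h6
    have h8 := mul_le_mul_of_nonneg_left h6 hrn.le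
    have h9 : Real.log (κ / (1 + τ)) = 2 * θ := by rw [hθ]; ring
    rw [h9]
    linarith

theorem exponentM_coincidenceTest {m : ℕ → ℕ} (hm : Tendsto m atTop atTop)
    (hnm : Tendsto (fun n : ℕ => (n : ℝ) / m n) atTop (𝓝 0))
    (hr : Tendsto (fun n : ℕ => (n : ℝ) ^ 2 / m n) atTop atTop) {ε : ℝ} (h0 : 0 < ε)
    (h1 : ε < 1) {τ : ℝ} (hτ : 0 ≤ τ) (hτκ : τ ≤ kappaLow ε - 1) {τs : ℕ → ℝ}
    (hτs : Tendsto (fun n : ℕ => (m n : ℝ) * τs n / (n : ℝ) ^ 2) atTop (𝓝 τ)) :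
    exponentM ε (coincidenceTest m τs) = JMstar ε τ := by
  have hτ1 : 0 < 1 + τ := by linarith
  have hκ0 : 0 < kappaLow ε := zero_lt_one.trans_le (one_le_kappaLow h1)
  have hm0 := hm.eventually_gt_atTop 0
  have ht := tendsto_threshold hm0 hnm hτs
  rw [JMstar_eq hτ hτκ]
  unfold exponentM missedDetection
  simp only [setOf_coincidenceTest_eq_zero]
  set t : ℕ → ℝ := fun n =>
    n + (iidExp (uniformPMF (m n)) (coincidenceStat (m := m n) (n := n)) + τs n)
  refine genErrorExponent_eq_coe (hr.eventually_gt_atTop 0) (fun η hη => ?_) (fun η hη => ?_)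
  · filter_upwards [eventually_missedDetection_le hm0 hnm hr h0 h1 hτ hτκ ht hη] with n hn
    exact iSup₂_le fun q hq => ENNReal.ofReal_le_ofReal (hn q hq)
  · obtain ⟨q, C, hC, hqalt, hqC, hqκ⟩ := exists_extremal_alternatives hm h0 h1
    -- The largest even value of the statistic below the threshold `t n` is `2 * (⌈t n / 2⌉₊ - 1)`.
    have hceil := tendsto_ceil_half_div hr hτ1 ht
    have hk : Tendsto (fun n : ℕ => ((⌈t n / 2⌉₊ - 1 : ℕ) : ℝ) / ((n : ℝ) ^ 2 / m n)) atTop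
        (𝓝 ((1 + τ) / 2)) := by
      have h := hceil.sub hr.inv_tendsto_atTop
      rw [sub_zero] at h
      refine h.congr' ?_
      filter_upwards [hr.eventually_gt_atTop 0, ht.eventually (lt_mem_nhds hτ1)] with n hrn htn
      have ht0 : 0 < t n := (div_pos_iff_of_pos_right hrn).1 htn
      have : 1 ≤ ⌈t n / 2⌉₊ := Nat.one_le_ceil_iff.2 (by positivity)
      rw [Nat.cast_sub this, Nat.cast_one, sub_div, Pi.inv_apply, one_div]
    have hlb := eventually_exp_le_iidProb hm0 hnm hr (hqalt.mono fun n hn => hn.1) hC hqC hκ0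
      hqκ (half_pos hτ1) hk hη
    filter_upwards [hlb, hqalt, hr.eventually_gt_atTop 0, ht.eventually (lt_mem_nhds hτ1)]
      with n hn hqn hrn htn
    have ht0 : 0 < t n := (div_pos_iff_of_pos_right hrn).1 htn
    have hJ : kappaLow ε / 2 - (1 + τ) / 2 -
        (1 + τ) / 2 * Real.log (kappaLow ε / (2 * ((1 + τ) / 2))) =
        (kappaLow ε - (1 + τ) - (1 + τ) * Real.log (kappaLow ε / (1 + τ))) / 2 := by
      rw [mul_div_cancel₀ _ (two_ne_zero)]
      ring
    rw [hJ] at hn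
    refine le_trans ?_ (le_iSup₂_of_le (q n) hqn le_rfl)
    refine ENNReal.ofReal_le_ofReal (hn.trans (iidProb_mono hqn.1.1 ?_))
    intro z hz
    have hz' : collisionStat z = 2 * (⌈t n / 2⌉₊ - 1) := hz
    have h2 : 1 ≤ ⌈t n / 2⌉₊ := Nat.one_le_ceil_iff.2 (by positivity)
    have h3 := Nat.ceil_lt_add_one (by positivity : 0 ≤ t n / 2)
    simp only [Set.mem_ofPred_eq, hz']
    rw [Nat.cast_mul, Nat.cast_sub h2]
    push_cast
    linarith

end SmallSample

theorem theorem1 (m : ℕ → ℕ)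
    (hnm : (fun n : ℕ => (n : ℝ)) =o[atTop] (fun n : ℕ => (m n : ℝ)))
    (hmn : (fun n : ℕ => (m n : ℝ)) =o[atTop] (fun n : ℕ => (n : ℝ) ^ 2))
    (ε : ℝ) (hε0 : 0 < ε) (hε1 : ε < 1)
    (τ : ℝ) (hτ : τ ∈ Set.Icc 0 (SmallSample.kappaLow ε - 1))
    (τs : ℕ → ℝ)
    (hτs : Tendsto (fun n : ℕ => (m n : ℝ) * τs n / (n : ℝ) ^ 2) atTop (𝓝 τ)) :
    SmallSample.exponentF (SmallSample.coincidenceTest m τs) = SmallSample.JFstar τ ∧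
    SmallSample.exponentM ε (SmallSample.coincidenceTest m τs) = SmallSample.JMstar ε τ := by
  have hlim := hnm.tendsto_div_nhds_zero
  have hm : Tendsto m atTop atTop := by
    refine tendsto_atTop_mono' atTop ?_ tendsto_id
    filter_upwards [hnm.bound one_pos] with n hn
    simpa using hn
  have hm0 := hm.eventually_gt_atTop 0
  have hr : Tendsto (fun n : ℕ => (n : ℝ) ^ 2 / m n) atTop atTop := by
    have h : Tendsto (fun n : ℕ => (m n : ℝ) / (n : ℝ) ^ 2) atTop (𝓝[>] 0) := by
      refine tendsto_nhdsWithin_iff.2 ⟨hmn.tendsto_div_nhds_zero, ?_⟩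
      filter_upwards [hm0, eventually_gt_atTop 0] with n h1 h2
      exact Set.mem_Ioi.2 (by positivity)
    refine h.inv_tendsto_nhdsGT_zero.congr fun n => ?_
    simp
  exact ⟨SmallSample.exponentF_coincidenceTest hm0 hlim hr hτ.1 hτs,
    SmallSample.exponentM_coincidenceTest hm hlim hr hε0 hε1 hτ.1 hτ.2 hτs⟩
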